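/- Let $\Gamma$ be a metrized graph, i.e. a finite connected graph (multiple edges and self-loops allowed) with edges $e_1,\dots,e_e$ parametrized as segments of lengths $L_1,\dots,L_e>0$; let $\ell(\Gamma)=\sum_i L_i$. For $y,z\in\Gamma$ the voltage function $x\mapsto j_z(x,y)$ is the continuous, piecewise affine function on $\Gamma$ with $\Delta_x j_z(x,y)=\delta_y-\delta_z$ and $j_z(z,y)=0$, where $\Delta f=-\sum_{x}\big(\sum_{\vec v\text{ at }x}d_{\vec v}f(x)\big)\delta_x$ is minus the sum of outgoing slopes at each point. The resistance is $r(x,y)=j_x(y,y)$, and for $p,q\in\Gamma$ put $$A_{p,q,\Gamma}=\int_\Gamma j_x(p,q)\Big(\frac{d}{dx}j_p(x,q)\Big)^2dx .$$ Let $\mu_{can}$ be the canonical measure of $\Gamma$: the signed Borel measure with $\mu_{can}(\Gamma)=1$ for which $j_{\mu}(x,x)=\int_\Gamma j_\zeta(x,x)\,d\mu(\zeta)$ is constant in $x\in\Gamma$; the tau constant is $\tau(\Gamma)=\tfrac12 j_{\mu_{can}}(x,x)$. Suppose $\Gamma$ is bridgeless, i.e. for every edge $e_i$ the graph $\Gamma-e_i$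 obtained by deleting the interior of $e_i$ is connected. Let $p_i,q_i$ be the end points of $e_i$ and $R_i$ the resistance between $p_i$ and $q_i$ in $\Gamma-e_i$. Then a canonical measure exists, and $$\tau(\Gamma)=\frac{\ell(\Gamma)}{12}-\sum_{i=1}^{e}\frac{L_i\,A_{p_i,q_i,\Gamma-e_i}}{(L_i+R_i)^2}.$$ Consequently, if $\Gamma$ is bridgeless and $\ell(\Gamma)=1$, then $\tau(\Gamma)\le\frac1{12}$. This bound is sharp: the circle of length $1$ is bridgeless and has $\tau=\frac1{12}$. -/

import Mathlib

open MeasureTheory Set Filter Topology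

noncomputable section

/-- Combinatorial data of a metrized graph: a vertex set, a set of edges (multiple edges and
self-loops are allowed), for each edge its two end points and its positive length. The edge `e` is
parametrized by `[0, length e]`, starting at `src e` and ending at `tgt e`.
A metrized graph in the usual sense is such a datum that is finite and `Connected`. -/
structure MetrizedGraph (V : Type*) (E : Type*) where
  src : E → V
  tgt : E → V
  length : E → ℝ
  length_pos : ∀ e, 0 < length e

namespace MetrizedGraph

variable {V E : Type*}

/-- Any two vertices are joined by a path of edges (and there is at least one vertex). -/
def Connected (Γ : MetrizedGraph V E) : Prop :=
  (SimpleGraph.fromRel fun u v => ∃ e, Γ.src e = u ∧ Γ.tgt e = v).Connected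

/-- `Γ - e`: the interior points of the edge `e` are deleted; all vertices are kept. -/
def deleteEdge (Γ : MetrizedGraph V E) (e : E) : MetrizedGraph V {e' : E // e' ≠ e} where
  src e' := Γ.src e'
  tgt e' := Γ.tgt e'
  length e' := Γ.length e'
  length_pos e' := Γ.length_pos e'

/-- No edge is a bridge, i.e. no `Γ - e` is disconnected. -/
def Bridgeless (Γ : MetrizedGraph V E) : Prop :=
  ∀ e, (Γ.deleteEdge e).Connected

/-- `ℓ(Γ)`. -/
def totalLength [Fintype E] (Γ : MetrizedGraph V E) : ℝ :=
  ∑ e, Γ.length e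

/-- The points of `Γ` as a space: the vertices and the interior points of the edges. -/
inductive Point (Γ : MetrizedGraph V E) : Type _
  | vertex (v : V) : Point Γ
  | interior (e : E) (t : Ioo (0 : ℝ) (Γ.length e)) : Point Γ

open Classical in
/-- The parametrization of the edge `e` by `t ∈ [0, length e]`, extended to `ℝ` as a constant on
either side. -/
def pt (Γ : MetrizedGraph V E) (e : E) (t : ℝ) : Γ.Point :=
  if h : t ∈ Ioo (0 : ℝ) (Γ.length e) then Point.interior e ⟨t, h⟩
  else if t ≤ 0 then Point.vertex (Γ.src e) else Point.vertex (Γ.tgt e)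

/-- The quotient topology of `Γ`, as the union of the segments `[0, length e]` glued at the
vertices: a set is open iff its preimage under every edge parametrization is open. -/
instance (Γ : MetrizedGraph V E) : TopologicalSpace Γ.Point :=
  ⨆ e, TopologicalSpace.coinduced (Γ.pt e) inferInstance

instance (Γ : MetrizedGraph V E) : MeasurableSpace Γ.Point := borel _

instance (Γ : MetrizedGraph V E) : BorelSpace Γ.Point := ⟨rfl⟩

/-- `f` is continuous on `Γ`, and affine (in the parametrizations of the edges) near every point
outside a finite set. -/
def IsPiecewiseAffine (Γ : MetrizedGraph V E) (f : Γ.Point → ℝ) : Prop :=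
  Continuous f ∧ ∃ S : Set Γ.Point, S.Finite ∧
    ∀ e, ∀ t ∈ Ioo (0 : ℝ) (Γ.length e), Γ.pt e t ∉ S →
      ∃ a : ℝ, ∀ᶠ s in 𝓝 t, f (Γ.pt e s) = f (Γ.pt e t) + a * (s - t)

open Classical in
/-- The sum `∑ d_v f(x)` of the one-sided derivatives of `f` at `x` in all directions `v` emanating
from `x`. A self-loop at a vertex contributes two directions. -/
def outwardSlopeSum [Fintype E] (Γ : MetrizedGraph V E) (f : Γ.Point → ℝ) : Γ.Point → ℝ
  | .vertex v => ∑ e,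
      ((if Γ.src e = v then derivWithin (fun s => f (Γ.pt e s)) (Ici 0) 0 else 0) +
        (if Γ.tgt e = v then
          -derivWithin (fun s => f (Γ.pt e s)) (Iic (Γ.length e)) (Γ.length e) else 0))
  | .interior e t =>
      derivWithin (fun s => f (Γ.pt e s)) (Ici t.1) t.1 +
        -derivWithin (fun s => f (Γ.pt e s)) (Iic t.1) t.1

/-- The Laplacian `Δ f = -f'' dx - ∑ₓ (∑ d_v f(x)) δₓ` of a piecewise affine function has no
continuous part; this is its mass at the point `x`. -/
def laplacianMass [Fintype E] (Γ : MetrizedGraph V E) (f : Γ.Point → ℝ) (x : Γ.Point) : ℝ :=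
  -Γ.outwardSlopeSum f x

open Classical in
/-- `f` is the potential on the electric circuit `Γ` (the resistance of a segment is its length)
when unit current enters at `y` and exits at `z`, with reference potential `0` at `z`:
`Δ f = δ_y - δ_z` and `f z = 0`. -/
structure IsVoltage [Fintype E] (Γ : MetrizedGraph V E) (z y : Γ.Point)
    (f : Γ.Point → ℝ) : Prop where
  piecewiseAffine : Γ.IsPiecewiseAffine f
  laplacian : ∀ x, Γ.laplacianMass f x = (if x = y then 1 else 0) - (if x = z then 1 else 0)
  ground : f z = 0

/-- The voltage function `j_z(x, y)`. -/
def voltage [Fintype E] (Γ : MetrizedGraph V E) (z x y : Γ.Point) : ℝ :=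
  Classical.epsilon (fun f : Γ.Point → ℝ => Γ.IsVoltage z y f) x

/-- The resistance function `r(x, y) = j_x(y, y)`. -/
def resistance [Fintype E] (Γ : MetrizedGraph V E) (x y : Γ.Point) : ℝ :=
  Γ.voltage x y y

/-- `j_μ(x, y) = ∫ j_ζ(x, y) dμ(ζ)` for a (finite, real-valued) signed Borel measure `μ`. -/
def voltageIntegral [Fintype E] (Γ : MetrizedGraph V E) (μ : SignedMeasure Γ.Point)
    (x y : Γ.Point) : ℝ :=
  ∫ᵛ ζ, Γ.voltage ζ x y ∂<•μ

/-- `μ` has total mass `1` and `j_μ(x, x)` is constant on `Γ`. -/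
def IsCanonicalMeasure [Fintype E] (Γ : MetrizedGraph V E) (μ : SignedMeasure Γ.Point) : Prop :=
  μ univ = 1 ∧ ∃ c : ℝ, ∀ x, Γ.voltageIntegral μ x x = c

/-- The canonical measure `μ_can` of `Γ`. -/
def canonicalMeasure [Fintype E] (Γ : MetrizedGraph V E) : SignedMeasure Γ.Point :=
  Classical.epsilon Γ.IsCanonicalMeasure

/-- The tau constant `τ(Γ)`: the constant value of `j_μ(x, x) / 2` for `μ = μ_can`. -/
def tau [Fintype E] (Γ : MetrizedGraph V E) : ℝ :=
  Classical.epsilon fun t : ℝ =>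
    ∀ x, 1 / 2 * Γ.voltageIntegral Γ.canonicalMeasure x x = t

/-- `A_{p,q,Γ} = ∫_Γ j_x(p, q) (d/dx j_p(x, q))² dx`. -/
def A [Fintype E] (Γ : MetrizedGraph V E) (p q : Γ.Point) : ℝ :=
  ∑ e, ∫ t in (0 : ℝ)..Γ.length e,
    Γ.voltage (Γ.pt e t) p q * deriv (fun s => Γ.voltage p (Γ.pt e s) q) t ^ 2

/-- The circle of total length `1`, as one vertex with one self-loop. -/
def unitCircle : MetrizedGraph Unit Unit where
  src _ := ()
  tgt _ := ()
  length _ := 1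
  length_pos _ := one_pos

end MetrizedGraph

end

/-! Everything is reduced to finite sums in the Green kernel `G` of the weighted graph on the
vertices (conductance `1 / L` on an edge of length `L`, grounded at a vertex `o`). Interpolating `G`
affinely in both variables and adding the Dirichlet Green kernels of the edges gives a kernel `K` on
all points. Since harmonic functions are constant, voltages are unique, and j_z(x,y) = K(x,y) -
K(x,z) - K(z,y) + K(z,z) (`IsGreen.voltage_eq`).

Let r be the resistance in Γ between the ends p, q of an edge. The Chinburg–Rumely measure μ has
mass 1 by Foster's theorem and satisfies ∫ K(ζ,x) dμ(ζ) = K(x,x)/2. Hence the integral over ζ of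
K(ζ,ζ) + K(x,x) - 2K(ζ,x) does not depend on x. By Fubini every canonical measure yields the same
constant, so τ is the sum over the edges of ((L - r)²/12 + (G(p,p) - G(q,q))²/4)/L
(`IsGreen.tau_eq`).

Deleting an edge changes `G` by a rank-one term, which turns A and R of Γ - e into expressions in
`G`. The sum over all e is evaluated by applying the reproducing property of `G` to quadratic and
cubic polynomials in its columns, together with reciprocity (`IsGreen.sum_sum_meanVoltage`,
`IsGreen.sum_deleteEdge_meanVoltage`); it equals ℓ/12 - τ. The bound holds because voltages, and
therefore A, are nonnegative. For the circle, Γ - e has no edge and A vanishes. -/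

noncomputable section

/-! ### Green kernels of finite weighted graphs. -/

namespace MetrizedGraph

variable {V E : Type*}

/-- A function on the vertices that is constant along every edge of a connected graph is
constant. -/
theorem Connected.eq_of_forall_edge {Γ : MetrizedGraph V E} (hΓ : Γ.Connected) {α : Type*}
    {φ : V → α} (h : ∀ e, φ (Γ.src e) = φ (Γ.tgt e)) (u v : V) : φ u = φ v := by
  obtain ⟨w⟩ := hΓ.preconnected u v
  induction w with
  | nil => rfl
  | cons hadj _ ih =>
    refine Eq.trans ?_ ih
    rw [SimpleGraph.fromRel_adj] at hadj
    rcases hadj.2 with ⟨e, rfl, rfl⟩ | ⟨e, rfl, rfl⟩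
    · exact h e
    · exact (h e).symm

section Green

variable [Fintype E]

/-- `G` is the Green kernel of the weighted graph underlying `Γ` (an edge of length `L` has
conductance `1 / L`), grounded at the vertex `o`: it reproduces the functions vanishing at `o` with
respect to the energy form. -/
structure IsGreen (Γ : MetrizedGraph V E) (o : V) (G : V → V → ℝ) : Prop where
  symm : ∀ u v, G u v = G v u
  ground : ∀ v, G o v = 0
  reproducing : ∀ (φ : V → ℝ) (v : V),
    ∑ e, (φ (Γ.src e) - φ (Γ.tgt e)) * (G (Γ.src e) v - G (Γ.tgt e) v) / Γ.length e = φ v - φ o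

open Classical in
/-- The Laplacian of the weighted graph underlying `Γ`. -/
def vertexLaplacian (Γ : MetrizedGraph V E) (φ : V → ℝ) (v : V) : ℝ :=
  ∑ e, ((if Γ.src e = v then 1 else 0) - (if Γ.tgt e = v then 1 else 0)) *
    (φ (Γ.src e) - φ (Γ.tgt e)) / Γ.length e

-- Summation by parts: it turns the Laplacian into the energy form.
open Classical in
theorem sum_mul_vertexLaplacian [Fintype V] (Γ : MetrizedGraph V E) (ψ φ : V → ℝ) :
    ∑ v, ψ v * Γ.vertexLaplacian φ v =
      ∑ e, (ψ (Γ.src e) - ψ (Γ.tgt e)) * (φ (Γ.src e) - φ (Γ.tgt e)) / Γ.length e := by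
  simp only [vertexLaplacian, Finset.mul_sum]
  rw [Finset.sum_comm]
  refine Finset.sum_congr rfl fun e _ => ?_
  have h : ∀ a : V, ∑ v, ψ v * (if a = v then (1 : ℝ) else 0) = ψ a := fun a => by simp
  rw [← h (Γ.src e), ← h (Γ.tgt e), ← Finset.sum_sub_distrib, Finset.sum_mul, Finset.sum_div]
  refine Finset.sum_congr rfl fun v _ => ?_
  ring

theorem Connected.eq_of_energy_eq_zero {Γ : MetrizedGraph V E} (hΓ : Γ.Connected) {φ : V → ℝ}
    (h : ∑ e, (φ (Γ.src e) - φ (Γ.tgt e)) * (φ (Γ.src e) - φ (Γ.tgt e)) / Γ.length e = 0)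
    (u v : V) : φ u = φ v := by
  refine hΓ.eq_of_forall_edge (fun e => ?_) u v
  have := (Finset.sum_eq_zero_iff_of_nonneg
    (fun e _ => div_nonneg (mul_self_nonneg _) (Γ.length_pos e).le)).1 h e (Finset.mem_univ e)
  rw [div_eq_zero_iff, or_iff_left (Γ.length_pos e).ne', mul_self_eq_zero] at this
  linarith

theorem Connected.eq_of_vertexLaplacian_eq_zero [Fintype V] {Γ : MetrizedGraph V E}
    (hΓ : Γ.Connected) {φ : V → ℝ} (h : ∀ v, Γ.vertexLaplacian φ v = 0) (u v : V) : φ u = φ v :=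
  hΓ.eq_of_energy_eq_zero (by rw [← Γ.sum_mul_vertexLaplacian φ φ]; simp [h]) u v

-- The Laplacian is singular only on constants. Adding the rank-one term φ(o)δ_o makes its quadratic
-- form definite, so `T` is injective, hence bijective, and T g = δ_v - δ_o can be solved.
open Classical in
theorem Connected.exists_isGreen [Fintype V] {Γ : MetrizedGraph V E} (hΓ : Γ.Connected) (o : V) :
    ∃ G, Γ.IsGreen o G := by
  let T : (V → ℝ) →ₗ[ℝ] (V → ℝ) :=
    { toFun := fun φ v => Γ.vertexLaplacian φ v + (if v = o then φ o else 0)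
      map_add' := fun φ ψ => by
        ext v
        have : Γ.vertexLaplacian (φ + ψ) v = Γ.vertexLaplacian φ v + Γ.vertexLaplacian ψ v := by
          simp only [vertexLaplacian, ← Finset.sum_add_distrib, Pi.add_apply]
          exact Finset.sum_congr rfl fun e _ => by ring
        simp only [this, Pi.add_apply]
        split_ifs <;> ring
      map_smul' := fun c φ => by
        ext v
        have : Γ.vertexLaplacian (c • φ) v = c * Γ.vertexLaplacian φ v := by
          simp only [vertexLaplacian, Finset.mul_sum, Pi.smul_apply, smul_eq_mul]
          exact Finset.sum_congr rfl fun e _ => by ring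
        simp only [this, Pi.smul_apply, smul_eq_mul, RingHom.id_apply]
        split_ifs <;> ring }
  have hT : ∀ ψ φ : V → ℝ, ∑ v, ψ v * T φ v =
      ∑ e, (ψ (Γ.src e) - ψ (Γ.tgt e)) * (φ (Γ.src e) - φ (Γ.tgt e)) / Γ.length e
        + ψ o * φ o := fun ψ φ => by
    rw [← Γ.sum_mul_vertexLaplacian]
    simp [T, mul_add, Finset.sum_add_distrib]
  have hinj : Function.Injective T := by
    rw [injective_iff_map_eq_zero]
    intro φ hφ
    have h := hT φ φ
    simp only [hφ, Pi.zero_apply, mul_zero, Finset.sum_const_zero] at h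
    have h1 : 0 ≤ ∑ e, (φ (Γ.src e) - φ (Γ.tgt e)) * (φ (Γ.src e) - φ (Γ.tgt e)) / Γ.length e :=
      Finset.sum_nonneg fun e _ => div_nonneg (mul_self_nonneg _) (Γ.length_pos e).le
    have h2 := mul_self_nonneg (φ o)
    have h3 : φ o = 0 := mul_self_eq_zero.1 (by linarith)
    ext v
    rw [hΓ.eq_of_energy_eq_zero (φ := φ) (by linarith) v o, h3, Pi.zero_apply]
  have hsurj := LinearMap.injective_iff_surjective.1 hinj
  choose g hg using fun v : V => hsurj (Pi.single v 1 - Pi.single o 1)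
  have hpair : ∀ (v : V) (ψ : V → ℝ),
      ∑ e, (ψ (Γ.src e) - ψ (Γ.tgt e)) * (g v (Γ.src e) - g v (Γ.tgt e)) / Γ.length e + ψ o * g v o = ψ v - ψ o := fun v ψ => by
    rw [← hT, hg]
    simp [mul_sub, Finset.sum_sub_distrib, Pi.single_apply]
  -- Constants have no energy, so pairing with 1 isolates the extra term; its vanishing shows that
  -- `g v` solves the unperturbed equation.
  have h0 : ∀ v, g v o = 0 := fun v => by simpa using hpair v (fun _ => 1)
  have hsymm : ∀ u v, g u v = g v u := fun u v => by
    have h1 := hpair v (g u)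
    have h2 := hpair u (g v)
    simp only [h0, mul_zero, add_zero, sub_zero] at h1 h2
    rw [← h1, ← h2]
    exact Finset.sum_congr rfl fun e _ => by ring
  refine ⟨fun u v => g v u, fun u v => hsymm v u, h0, fun φ v => ?_⟩
  simpa [h0] using hpair v φ

namespace IsGreen

variable {Γ : MetrizedGraph V E} {o : V} {G : V → V → ℝ}

theorem vertexLaplacian_eq [DecidableEq V] (hG : Γ.IsGreen o G) (v w : V) :
    Γ.vertexLaplacian (fun u => G u w) v = (if w = v then 1 else 0) - (if o = v then 1 else 0) := by
  have := hG.reproducing (fun u => if u = v then 1 else 0) w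
  rw [← this, vertexLaplacian]
  refine Finset.sum_congr rfl fun e _ => ?_
  congr!

/-- The effective resistance between the end points of the edge `e`. -/
def _root_.MetrizedGraph.edgeResistance (Γ : MetrizedGraph V E) (G : V → V → ℝ) (e : E) : ℝ :=
  G (Γ.src e) (Γ.src e) + G (Γ.tgt e) (Γ.tgt e) - 2 * G (Γ.src e) (Γ.tgt e)

/-- Reproducing property with respect to the difference of two columns of the Green kernel. -/
theorem reproducing_sub (hG : Γ.IsGreen o G) (φ : V → ℝ) (v w : V) :
    ∑ e, (φ (Γ.src e) - φ (Γ.tgt e)) *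
      ((G (Γ.src e) v - G (Γ.src e) w) - (G (Γ.tgt e) v - G (Γ.tgt e) w)) / Γ.length e =
    φ v - φ w := by
  have h1 := hG.reproducing φ v
  have h2 := hG.reproducing φ w
  have : φ v - φ w = (φ v - φ o) - (φ w - φ o) := by ring
  rw [this, ← h1, ← h2, ← Finset.sum_sub_distrib]
  exact Finset.sum_congr rfl fun e _ => by ring

/-- The energy dissipated by a unit current equals the effective resistance. -/
theorem sum_sq_div (hG : Γ.IsGreen o G) (e : E) :
    ∑ f, ((G (Γ.src f) (Γ.src e) - G (Γ.src f) (Γ.tgt e)) -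
      (G (Γ.tgt f) (Γ.src e) - G (Γ.tgt f) (Γ.tgt e))) ^ 2 / Γ.length f =
    Γ.edgeResistance G e := by
  have h := hG.reproducing_sub (fun u => G u (Γ.src e) - G u (Γ.tgt e)) (Γ.src e) (Γ.tgt e)
  rw [edgeResistance]
  have h2 := hG.symm (Γ.src e) (Γ.tgt e)
  simp only [← sq] at h
  rw [h, h2]
  ring

/-- The energy r of the unit current is at least the part r²/L dissipated in `e` itself. -/
theorem edgeResistance_le (hG : Γ.IsGreen o G) (e : E) :
    Γ.edgeResistance G e ≤ Γ.length e := by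
  have h := Finset.single_le_sum (f := fun f =>
    ((G (Γ.src f) (Γ.src e) - G (Γ.src f) (Γ.tgt e)) -
      (G (Γ.tgt f) (Γ.src e) - G (Γ.tgt f) (Γ.tgt e))) ^ 2 / Γ.length f)
    (fun f _ => div_nonneg (sq_nonneg _) (Γ.length_pos f).le) (Finset.mem_univ e)
  rw [hG.sum_sq_div e] at h
  have h1 : (G (Γ.src e) (Γ.src e) - G (Γ.src e) (Γ.tgt e)) -
      (G (Γ.tgt e) (Γ.src e) - G (Γ.tgt e) (Γ.tgt e)) = Γ.edgeResistance G e := by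
    rw [edgeResistance, hG.symm (Γ.tgt e)]
    ring
  simp only [h1] at h
  have hL := Γ.length_pos e
  rw [div_le_iff₀ hL] at h
  by_contra! hlt
  nlinarith

/-- The trace of the Green kernel against a multiplication operator. -/
theorem sum_sub_ground [Fintype V] (hG : Γ.IsGreen o G) (ψ : V → ℝ) :
    ∑ v, ψ v - ψ o = ∑ e, (ψ (Γ.src e) * (G (Γ.src e) (Γ.src e) - G (Γ.src e) (Γ.tgt e)) +
      ψ (Γ.tgt e) * (G (Γ.tgt e) (Γ.tgt e) - G (Γ.src e) (Γ.tgt e))) / Γ.length e := by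
  classical
  -- The indicator of `v` is reproduced at `v` itself; summing over `v` with weights `ψ v` takes a
  -- trace.
  have h1 : ∀ v, ψ v * (1 - if v = o then 1 else 0) =
      ∑ e, ψ v * (((if Γ.src e = v then 1 else 0) - (if Γ.tgt e = v then 1 else 0)) *
        (G (Γ.src e) v - G (Γ.tgt e) v) / Γ.length e) := fun v => by
    rw [← Finset.mul_sum, hG.reproducing (fun u => if u = v then 1 else 0) v]
    simp [eq_comm]
  have h2 : ∑ v, ψ v - ψ o = ∑ v, ψ v * (1 - if v = o then 1 else 0) := by
    simp [mul_sub, Finset.sum_sub_distrib]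
  rw [h2, Finset.sum_congr rfl fun v _ => h1 v, Finset.sum_comm]
  refine Finset.sum_congr rfl fun e _ => ?_
  have h3 : ∀ v, ψ v * (((if Γ.src e = v then 1 else 0) - (if Γ.tgt e = v then 1 else 0)) *
        (G (Γ.src e) v - G (Γ.tgt e) v) / Γ.length e) =
      (if Γ.src e = v then ψ v * (G (Γ.src e) v - G (Γ.tgt e) v) / Γ.length e else 0) -
      (if Γ.tgt e = v then ψ v * (G (Γ.src e) v - G (Γ.tgt e) v) / Γ.length e else 0) := fun v => by
    split_ifs <;> ring
  rw [Finset.sum_congr rfl fun v _ => h3 v, Finset.sum_sub_distrib, Finset.sum_ite_eq,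
    Finset.sum_ite_eq, if_pos (Finset.mem_univ _), if_pos (Finset.mem_univ _),
    hG.symm (Γ.tgt e) (Γ.src e)]
  ring

/-- Foster's theorem. -/
theorem sum_edgeResistance_div [Fintype V] (hG : Γ.IsGreen o G) :
    ∑ e, Γ.edgeResistance G e / Γ.length e = Fintype.card V - 1 := by
  have h := hG.sum_sub_ground (fun _ => 1)
  simp only [Finset.sum_const, Finset.card_univ, nsmul_eq_mul, mul_one, one_mul] at h
  rw [h]
  refine Finset.sum_congr rfl fun e _ => ?_
  rw [edgeResistance]
  ring

/-- This is the discrete form of ∫ K(ζ,x) dμ(ζ) = K(x,x)/2. It combines the trace formula for a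
column of `G` with the reproduction of the diagonal. -/
theorem diag_eq [Fintype V] (hG : Γ.IsGreen o G) (v : V) :
    G v v = 2 * ∑ u, G u v -
      ∑ e, Γ.edgeResistance G e / Γ.length e * (G (Γ.src e) v + G (Γ.tgt e) v) := by
  have h := hG.sum_sub_ground (fun u => G u v)
  have h1 := hG.reproducing (fun u => G u u) v
  simp only [hG.ground, sub_zero] at h h1
  rw [h, ← h1, Finset.mul_sum, ← Finset.sum_sub_distrib]
  refine Finset.sum_congr rfl fun e _ => ?_
  rw [edgeResistance]
  ring

/-- The trace formula for the diagonal of `G`; it later trades the vertex masses in ∫ K(x,x) dμ for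
a sum over edges. -/
theorem two_mul_sum_diag [Fintype V] (hG : Γ.IsGreen o G) :
    2 * ∑ v, G v v = ∑ e, (Γ.edgeResistance G e * (G (Γ.src e) (Γ.src e) + G (Γ.tgt e) (Γ.tgt e)) +
      (G (Γ.src e) (Γ.src e) - G (Γ.tgt e) (Γ.tgt e)) ^ 2) / Γ.length e := by
  have h := hG.sum_sub_ground (fun u => G u u)
  simp only [hG.ground, sub_zero] at h
  rw [h, Finset.mul_sum]
  refine Finset.sum_congr rfl fun e _ => ?_
  rw [edgeResistance]
  ring

/-- The voltage between vertices is nonnegative. -/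
theorem voltage_nonneg (hG : Γ.IsGreen o G) (w p q : V) :
    0 ≤ G p q - G p w - G w q + G w w := by
  -- Maximum principle by truncation: the energy of the negative part `ψ` of the voltage `φ` is at
  -- most its pairing with `φ`, which is `ψ q ≤ 0`. So `ψ` has no energy, and the reproducing
  -- property gives `ψ p = ψ w = 0`.
  let φ : V → ℝ := fun u => G u q - G u w - G w q + G w w
  let ψ : V → ℝ := fun u => min (φ u) 0
  have hw : φ w = 0 := by simp only [φ]; ring
  have hψw : ψ w = 0 := by simp [ψ, hw]
  have hED : ∑ e, (ψ (Γ.src e) - ψ (Γ.tgt e)) ^ 2 / Γ.length e ≤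
      ∑ e, (ψ (Γ.src e) - ψ (Γ.tgt e)) *
        ((G (Γ.src e) q - G (Γ.src e) w) - (G (Γ.tgt e) q - G (Γ.tgt e) w)) / Γ.length e := by
    refine Finset.sum_le_sum fun e _ => ?_
    have hL := Γ.length_pos e
    gcongr
    have : (G (Γ.src e) q - G (Γ.src e) w) - (G (Γ.tgt e) q - G (Γ.tgt e) w) =
      φ (Γ.src e) - φ (Γ.tgt e) := by simp only [φ]; ring
    rw [this]
    simp only [ψ]
    rcases le_total (φ (Γ.src e)) 0 with h1 | h1 <;> rcases le_total (φ (Γ.tgt e)) 0 with h2 | h2 <;>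
      simp only [min_eq_left, min_eq_right, h1, h2] <;> nlinarith
  rw [hG.reproducing_sub ψ q w, hψw, sub_zero] at hED
  have hq : ψ q ≤ 0 := min_le_right _ _
  have hE : ∀ e, ψ (Γ.src e) - ψ (Γ.tgt e) = 0 := fun e => by
    have h0 : ∀ e ∈ Finset.univ, 0 ≤ (ψ (Γ.src e) - ψ (Γ.tgt e)) ^ 2 / Γ.length e :=
      fun e _ => div_nonneg (sq_nonneg _) (Γ.length_pos e).le
    have := (Finset.sum_eq_zero_iff_of_nonneg h0).1
      (le_antisymm (hED.trans hq) (Finset.sum_nonneg h0)) e (Finset.mem_univ e)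
    rw [div_eq_zero_iff, or_iff_left (Γ.length_pos e).ne'] at this
    exact pow_eq_zero_iff (two_ne_zero) |>.1 this
  have h := hG.reproducing_sub ψ p w
  simp only [hE, zero_mul, zero_div, Finset.sum_const_zero, hψw, sub_zero] at h
  have : 0 ≤ φ p := by
    rw [← min_eq_right_iff]
    exact h.symm
  exact this

end IsGreen

end Green

end MetrizedGraph

/-! ### Deletion of an edge and the identities for mean voltages. -/

namespace MetrizedGraph

variable {V E : Type*}

/-- The potential at `u` of a unit current through the circuit from one end of `e` to the other,
up to a constant. -/
def edgePotential (Γ : MetrizedGraph V E) (G : V → V → ℝ) (e : E) (u : V) : ℝ :=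
  G u (Γ.src e) - G u (Γ.tgt e)

/-- The mean over `x` in the edge `f` of the voltage `j_x(p, q)`, in terms of the Green kernel. -/
def meanVoltage (Γ : MetrizedGraph V E) (G : V → V → ℝ) (p q : V) (f : E) : ℝ :=
  G p q - (G p (Γ.src f) + G p (Γ.tgt f) + G q (Γ.src f) + G q (Γ.tgt f)) / 2 +
    (G (Γ.src f) (Γ.src f) + G (Γ.tgt f) (Γ.tgt f) + G (Γ.src f) (Γ.tgt f)) / 3 + Γ.length f / 6

/-- The Green kernel of `Γ - e`, in terms of that of `Γ`. -/
def deletedKernel (Γ : MetrizedGraph V E) (G : V → V → ℝ) (e : E) (u v : V) : ℝ :=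
  G u v + Γ.edgePotential G e u * Γ.edgePotential G e v /
    (Γ.length e - Γ.edgeResistance G e)

variable [Fintype E]

theorem sum_deleteEdge [DecidableEq E] (e : E) (F : E → ℝ) :
    ∑ f : {f : E // f ≠ e}, F f = ∑ f, F f - F e := by
  rw [Fintype.sum_eq_add_sum_subtype_ne F e]
  ring

namespace IsGreen

variable {Γ : MetrizedGraph V E} {o : V} {G : V → V → ℝ}

theorem edgePotential_sub (hG : Γ.IsGreen o G) (e : E) :
    Γ.edgePotential G e (Γ.src e) - Γ.edgePotential G e (Γ.tgt e) = Γ.edgeResistance G e := by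
  rw [edgePotential, edgePotential, edgeResistance, hG.symm (Γ.tgt e) (Γ.src e)]
  ring

theorem reproducing_edgePotential (hG : Γ.IsGreen o G) (φ : V → ℝ) (e : E) :
    ∑ f, (φ (Γ.src f) - φ (Γ.tgt f)) *
      (Γ.edgePotential G e (Γ.src f) - Γ.edgePotential G e (Γ.tgt f)) / Γ.length f =
    φ (Γ.src e) - φ (Γ.tgt e) :=
  hG.reproducing_sub φ _ _

/-- If r = L, then `e` dissipates all the energy, so the potential is constant on the connected
graph Γ - e. Its values at the two ends of `e` then agree, forcing r = 0. -/
theorem edgeResistance_lt [DecidableEq E] (hG : Γ.IsGreen o G) {e : E}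
    (he : (Γ.deleteEdge e).Connected) : Γ.edgeResistance G e < Γ.length e := by
  refine lt_of_le_of_ne (hG.edgeResistance_le e) fun heq => ?_
  have hL := Γ.length_pos e
  have h := hG.reproducing_edgePotential (Γ.edgePotential G e) e
  have hsub := sum_deleteEdge e fun f =>
    (Γ.edgePotential G e (Γ.src f) - Γ.edgePotential G e (Γ.tgt f)) *
      (Γ.edgePotential G e (Γ.src f) - Γ.edgePotential G e (Γ.tgt f)) / Γ.length f
  rw [h, hG.edgePotential_sub, heq, mul_div_cancel_right₀ _ hL.ne', sub_self] at hsub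
  have := he.eq_of_energy_eq_zero (φ := Γ.edgePotential G e) hsub (Γ.src e) (Γ.tgt e)
  have h2 := hG.edgePotential_sub e
  linarith

/-- Deletion subtracts a rank-one operator from the Laplacian, and `deletedKernel` is the
Sherman–Morrison formula for the inverse. -/
theorem deleteEdge [DecidableEq E] (hG : Γ.IsGreen o G) {e : E}
    (he : Γ.edgeResistance G e < Γ.length e) :
    (Γ.deleteEdge e).IsGreen o (Γ.deletedKernel G e) where
  symm u v := by
    rw [deletedKernel, deletedKernel, hG.symm u v]
    ring
  ground v := by
    simp [deletedKernel, edgePotential, hG.ground]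
  reproducing φ v := by
    have hL := (Γ.length_pos e).ne'
    have hLr : Γ.length e - Γ.edgeResistance G e ≠ 0 := (sub_pos.2 he).ne'
    have h1 := hG.reproducing φ v
    have h2 := hG.reproducing_edgePotential φ e
    have h3 := hG.edgePotential_sub e
    have h4 : Γ.edgePotential G e v = G (Γ.src e) v - G (Γ.tgt e) v := by
      rw [edgePotential, hG.symm v, hG.symm v]
    refine (sum_deleteEdge e fun f => (φ (Γ.src f) - φ (Γ.tgt f)) *
      (Γ.deletedKernel G e (Γ.src f) v - Γ.deletedKernel G e (Γ.tgt f) v) / Γ.length f).trans ?_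
    have h5 : ∀ f, (φ (Γ.src f) - φ (Γ.tgt f)) *
        (Γ.deletedKernel G e (Γ.src f) v - Γ.deletedKernel G e (Γ.tgt f) v) / Γ.length f =
        (φ (Γ.src f) - φ (Γ.tgt f)) * (G (Γ.src f) v - G (Γ.tgt f) v) / Γ.length f +
        (φ (Γ.src f) - φ (Γ.tgt f)) *
          (Γ.edgePotential G e (Γ.src f) - Γ.edgePotential G e (Γ.tgt f)) / Γ.length f *
          (Γ.edgePotential G e v / (Γ.length e - Γ.edgeResistance G e)) := fun f => by
      rw [deletedKernel, deletedKernel]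
      ring
    rw [Finset.sum_congr rfl fun f _ => h5 f, h5 e, Finset.sum_add_distrib, ← Finset.sum_mul, h1,
      h2, h3, ← h4]
    field_simp
    ring

/-- Of a unit current between the ends of `e`, the fraction r/L flows through `e` and (L - r)/L
through Γ - e. A unit current in Γ - e therefore has its potential differences scaled by L/(L - r).
-/
theorem edgePotential_deletedKernel_sub (hG : Γ.IsGreen o G) {e : E}
    (he : Γ.edgeResistance G e < Γ.length e) (u v : V) :
    (Γ.deletedKernel G e u (Γ.src e) - Γ.deletedKernel G e u (Γ.tgt e)) -
      (Γ.deletedKernel G e v (Γ.src e) - Γ.deletedKernel G e v (Γ.tgt e)) =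
    Γ.length e / (Γ.length e - Γ.edgeResistance G e) *
      (Γ.edgePotential G e u - Γ.edgePotential G e v) := by
  have hLr : Γ.length e - Γ.edgeResistance G e ≠ 0 := (sub_pos.2 he).ne'
  have h3 := hG.edgePotential_sub e
  have h4 : ∀ w, G w (Γ.src e) = G w (Γ.tgt e) + Γ.edgePotential G e w := fun w => by
    rw [edgePotential]; ring
  have h5 : Γ.edgePotential G e (Γ.src e) =
    Γ.edgePotential G e (Γ.tgt e) + Γ.edgeResistance G e := by linarith
  simp only [deletedKernel, h4, h5]
  field_simp
  ring

/-- The resistance between the end points of `e` in `Γ - e`. -/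
theorem deletedKernel_resistance (hG : Γ.IsGreen o G) {e : E}
    (he : Γ.edgeResistance G e < Γ.length e) :
    Γ.deletedKernel G e (Γ.src e) (Γ.src e) + Γ.deletedKernel G e (Γ.tgt e) (Γ.tgt e) -
      2 * Γ.deletedKernel G e (Γ.src e) (Γ.tgt e) =
    Γ.length e * Γ.edgeResistance G e / (Γ.length e - Γ.edgeResistance G e) := by
  have hLr : Γ.length e - Γ.edgeResistance G e ≠ 0 := (sub_pos.2 he).ne'
  have h := hG.edgePotential_deletedKernel_sub he (Γ.src e) (Γ.tgt e)
  have hs : Γ.deletedKernel G e (Γ.tgt e) (Γ.src e) = Γ.deletedKernel G e (Γ.src e) (Γ.tgt e) := by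
    rw [deletedKernel, deletedKernel, hG.symm (Γ.tgt e)]
    ring
  rw [hG.edgePotential_sub, hs] at h
  rw [mul_div_right_comm, ← h]
  ring

/-- With h = `edgePotential` and a, b its values at the ends of `e`, the bracket is the difference
quotient along `f` of abh - (a + b)h²/2 + h³/3. The reproducing property reduces the sum to the
difference of this cubic between a and b, which is -(a - b)³/6. It evaluates the rank-one correction
of the mean voltages. -/
theorem edgePotential_cubic (hG : Γ.IsGreen o G) (e : E) :
    ∑ f, (Γ.edgePotential G e (Γ.src f) - Γ.edgePotential G e (Γ.tgt f)) ^ 2 / Γ.length f *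
      (Γ.edgePotential G e (Γ.src e) * Γ.edgePotential G e (Γ.tgt e) -
        (Γ.edgePotential G e (Γ.src e) + Γ.edgePotential G e (Γ.tgt e)) *
          (Γ.edgePotential G e (Γ.src f) + Γ.edgePotential G e (Γ.tgt f)) / 2 +
        (Γ.edgePotential G e (Γ.src f) ^ 2 + Γ.edgePotential G e (Γ.tgt f) ^ 2 +
          Γ.edgePotential G e (Γ.src f) * Γ.edgePotential G e (Γ.tgt f)) / 3) =
    -Γ.edgeResistance G e ^ 3 / 6 := by
  rw [← hG.edgePotential_sub]
  have h := hG.reproducing_edgePotential (fun u =>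
    Γ.edgePotential G e u * (Γ.edgePotential G e (Γ.src e) * Γ.edgePotential G e (Γ.tgt e)) -
    (Γ.edgePotential G e (Γ.src e) + Γ.edgePotential G e (Γ.tgt e)) *
      Γ.edgePotential G e u ^ 2 / 2 + Γ.edgePotential G e u ^ 3 / 3) e
  refine Eq.trans (Finset.sum_congr rfl fun f _ => ?_) (h.trans ?_)
  · ring
  · ring

/-- The summand, cubic in two columns of `G`, splits into energy pairings of quadratic functions of
these columns with the columns or their difference. Each pairing is evaluated by the reproducing
property. -/
theorem sum_edgePotential_sq_mul (hG : Γ.IsGreen o G) (f : E) :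
    ∑ e, (Γ.edgePotential G f (Γ.src e) - Γ.edgePotential G f (Γ.tgt e)) ^ 2 / Γ.length e *
      (G (Γ.src e) (Γ.src f) + G (Γ.src e) (Γ.tgt f) + G (Γ.tgt e) (Γ.src f) +
        G (Γ.tgt e) (Γ.tgt f)) =
    (G (Γ.src f) (Γ.src f) - G (Γ.tgt f) (Γ.tgt f)) ^ 2 / 2 +
      2 * Γ.edgeResistance G f * (G (Γ.src f) (Γ.src f) + G (Γ.tgt f) (Γ.tgt f)) -
      3 / 2 * Γ.edgeResistance G f ^ 2 := by
  have h1 := hG.reproducing_edgePotential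
    (fun u => G u (Γ.src f) ^ 2 - G u (Γ.tgt f) ^ 2) f
  have h2 := hG.reproducing
    (fun u => G u (Γ.tgt f) * (G u (Γ.src f) - G u (Γ.tgt f))) (Γ.src f)
  have h3 := hG.reproducing
    (fun u => G u (Γ.src f) * (G u (Γ.src f) - G u (Γ.tgt f))) (Γ.tgt f)
  have h4 : ∀ e, (Γ.edgePotential G f (Γ.src e) - Γ.edgePotential G f (Γ.tgt e)) ^ 2 /
      Γ.length e * (G (Γ.src e) (Γ.src f) + G (Γ.src e) (Γ.tgt f) + G (Γ.tgt e) (Γ.src f) +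
        G (Γ.tgt e) (Γ.tgt f)) =
      ((G (Γ.src e) (Γ.src f) ^ 2 - G (Γ.src e) (Γ.tgt f) ^ 2) -
        (G (Γ.tgt e) (Γ.src f) ^ 2 - G (Γ.tgt e) (Γ.tgt f) ^ 2)) *
        (Γ.edgePotential G f (Γ.src e) - Γ.edgePotential G f (Γ.tgt e)) / Γ.length e +
      2 * ((G (Γ.src e) (Γ.tgt f) * (G (Γ.src e) (Γ.src f) - G (Γ.src e) (Γ.tgt f)) -
        G (Γ.tgt e) (Γ.tgt f) * (G (Γ.tgt e) (Γ.src f) - G (Γ.tgt e) (Γ.tgt f))) *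
        (G (Γ.src e) (Γ.src f) - G (Γ.tgt e) (Γ.src f)) / Γ.length e) -
      2 * ((G (Γ.src e) (Γ.src f) * (G (Γ.src e) (Γ.src f) - G (Γ.src e) (Γ.tgt f)) -
        G (Γ.tgt e) (Γ.src f) * (G (Γ.tgt e) (Γ.src f) - G (Γ.tgt e) (Γ.tgt f))) *
        (G (Γ.src e) (Γ.tgt f) - G (Γ.tgt e) (Γ.tgt f)) / Γ.length e) := fun e => by
    rw [edgePotential, edgePotential]
    ring
  rw [Finset.sum_congr rfl fun e _ => h4 e, Finset.sum_sub_distrib, Finset.sum_add_distrib,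
    ← Finset.mul_sum, ← Finset.mul_sum, h1, h2, h3, edgeResistance, hG.ground, hG.ground,
    hG.symm (Γ.tgt f) (Γ.src f)]
  ring

/-- Reciprocity, the source of the symmetry used for double sums over edges. -/
theorem edgePotential_sub_comm (hG : Γ.IsGreen o G) (e f : E) :
    Γ.edgePotential G e (Γ.src f) - Γ.edgePotential G e (Γ.tgt f) =
      Γ.edgePotential G f (Γ.src e) - Γ.edgePotential G f (Γ.tgt e) := by
  simp only [edgePotential]
  rw [hG.symm (Γ.src f), hG.symm (Γ.src f), hG.symm (Γ.tgt f), hG.symm (Γ.tgt f)]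
  ring

theorem sum_edgePotential_sq (hG : Γ.IsGreen o G) (e : E) :
    ∑ f, (Γ.edgePotential G e (Γ.src f) - Γ.edgePotential G e (Γ.tgt f)) ^ 2 / Γ.length f =
      Γ.edgeResistance G e :=
  hG.sum_sq_div e

/-- The double sum of the mean voltages over all pairs of edges. -/
theorem sum_sum_meanVoltage (hG : Γ.IsGreen o G) :
    ∑ e, (∑ f, (Γ.edgePotential G e (Γ.src f) - Γ.edgePotential G e (Γ.tgt f)) ^ 2 / Γ.length f *
      Γ.meanVoltage G (Γ.src e) (Γ.tgt e) f) / Γ.length e =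
    ∑ e, (Γ.edgeResistance G e / 6 + (Γ.edgeResistance G e ^ 2 / 12 -
      (G (Γ.src e) (Γ.src e) - G (Γ.tgt e) (Γ.tgt e)) ^ 2 / 4) / Γ.length e) := by
  let W : E → E → ℝ := fun e f =>
    (Γ.edgePotential G e (Γ.src f) - Γ.edgePotential G e (Γ.tgt f)) ^ 2 / Γ.length f / Γ.length e
  have hW : ∀ e f, W e f = W f e := fun e f => by
    simp only [W]
    rw [hG.edgePotential_sub_comm e f]
    ring
  have hWsum : ∀ e, ∑ f, W e f = Γ.edgeResistance G e / Γ.length e := fun e => by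
    rw [← Finset.sum_div, hG.sum_edgePotential_sq]
  let S : E → E → ℝ := fun e f => G (Γ.src e) (Γ.src f) + G (Γ.src e) (Γ.tgt f) +
    G (Γ.tgt e) (Γ.src f) + G (Γ.tgt e) (Γ.tgt f)
  let a : E → ℝ := fun f =>
    (G (Γ.src f) (Γ.src f) + G (Γ.tgt f) (Γ.tgt f) + G (Γ.src f) (Γ.tgt f)) / 3 + Γ.length f / 6
  have h1 : ∀ e, (∑ f, (Γ.edgePotential G e (Γ.src f) - Γ.edgePotential G e (Γ.tgt f)) ^ 2 /
      Γ.length f * Γ.meanVoltage G (Γ.src e) (Γ.tgt e) f) / Γ.length e =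
      G (Γ.src e) (Γ.tgt e) * ∑ f, W e f - (∑ f, W e f * S e f) / 2 + ∑ f, W e f * a f :=
    fun e => by
    rw [Finset.mul_sum, Finset.sum_div, Finset.sum_div, ← Finset.sum_sub_distrib,
      ← Finset.sum_add_distrib]
    refine Finset.sum_congr rfl fun f _ => ?_
    simp only [W, S, a, meanVoltage]
    ring
  -- As `W` is symmetric, its column sums equal its row sums r/L, and the part depending on `f`
  -- alone collapses.
  have h2 : ∑ e, ∑ f, W e f * a f = ∑ e, Γ.edgeResistance G e / Γ.length e * a e := by
    rw [Finset.sum_comm]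
    refine Finset.sum_congr rfl fun f _ => ?_
    rw [← hWsum, Finset.sum_mul]
    exact Finset.sum_congr rfl fun e _ => by rw [hW]
  have h3 : ∀ e, ∑ f, W e f * S e f = ((G (Γ.src e) (Γ.src e) - G (Γ.tgt e) (Γ.tgt e)) ^ 2 / 2 +
      2 * Γ.edgeResistance G e * (G (Γ.src e) (Γ.src e) + G (Γ.tgt e) (Γ.tgt e)) -
      3 / 2 * Γ.edgeResistance G e ^ 2) / Γ.length e := fun e => by
    rw [← hG.sum_edgePotential_sq_mul, Finset.sum_div]
    refine Finset.sum_congr rfl fun f _ => ?_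
    simp only [W, S]
    rw [hG.symm (Γ.src e), hG.symm (Γ.src e), hG.symm (Γ.tgt e), hG.symm (Γ.tgt e)]
    ring
  rw [Finset.sum_congr rfl fun e _ => h1 e, Finset.sum_add_distrib, h2, ← Finset.sum_add_distrib]
  refine Finset.sum_congr rfl fun e _ => ?_
  have hL := (Γ.length_pos e).ne'
  rw [hWsum, h3]
  have hr : G (Γ.src e) (Γ.tgt e) =
      (G (Γ.src e) (Γ.src e) + G (Γ.tgt e) (Γ.tgt e) - Γ.edgeResistance G e) / 2 := by
    rw [edgeResistance]; ring
  simp only [a, hr]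
  field_simp
  ring

/-- The sum over the edges `e` of the contributions of `Γ - e`. -/
theorem sum_deleteEdge_meanVoltage [DecidableEq E] (hG : Γ.IsGreen o G)
    (hlt : ∀ e, Γ.edgeResistance G e < Γ.length e) :
    ∑ e, (∑ f : {f : E // f ≠ e},
      (Γ.edgePotential G e (Γ.src f) - Γ.edgePotential G e (Γ.tgt f)) ^ 2 / Γ.length f *
        (Γ.deleteEdge e).meanVoltage (Γ.deletedKernel G e) (Γ.src e) (Γ.tgt e) f) / Γ.length e =
    Γ.totalLength / 12 - ∑ e, ((Γ.length e - Γ.edgeResistance G e) ^ 2 / 12 +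
      (G (Γ.src e) (Γ.src e) - G (Γ.tgt e) (Γ.tgt e)) ^ 2 / 4) / Γ.length e := by
  have h1 : ∀ e, (∑ f : {f : E // f ≠ e},
      (Γ.edgePotential G e (Γ.src f) - Γ.edgePotential G e (Γ.tgt f)) ^ 2 / Γ.length f *
        (Γ.deleteEdge e).meanVoltage (Γ.deletedKernel G e) (Γ.src e) (Γ.tgt e) f) / Γ.length e =
      (∑ f, (Γ.edgePotential G e (Γ.src f) - Γ.edgePotential G e (Γ.tgt f)) ^ 2 / Γ.length f *
        Γ.meanVoltage G (Γ.src e) (Γ.tgt e) f) / Γ.length e -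
      Γ.edgeResistance G e ^ 2 / (6 * Γ.length e) := fun e => by
    have hL := (Γ.length_pos e).ne'
    have hLr : Γ.length e - Γ.edgeResistance G e ≠ 0 := (sub_pos.2 (hlt e)).ne'
    -- `N f / (L - r)` is the change of the mean voltage over `f` caused by the rank-one term of
    -- `deletedKernel`.
    let N : E → ℝ := fun f =>
      Γ.edgePotential G e (Γ.src e) * Γ.edgePotential G e (Γ.tgt e) -
        (Γ.edgePotential G e (Γ.src e) + Γ.edgePotential G e (Γ.tgt e)) *
          (Γ.edgePotential G e (Γ.src f) + Γ.edgePotential G e (Γ.tgt f)) / 2 +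
        (Γ.edgePotential G e (Γ.src f) ^ 2 + Γ.edgePotential G e (Γ.tgt f) ^ 2 +
          Γ.edgePotential G e (Γ.src f) * Γ.edgePotential G e (Γ.tgt f)) / 3
    have hN : N e = -Γ.edgeResistance G e ^ 2 / 6 := by
      rw [← hG.edgePotential_sub]
      ring
    have hQ : Γ.meanVoltage G (Γ.src e) (Γ.tgt e) e =
        (Γ.length e - Γ.edgeResistance G e) / 6 := by
      rw [meanVoltage, edgeResistance, hG.symm (Γ.tgt e) (Γ.src e)]
      ring
    -- The sum over `f ≠ e` is completed to all edges, so that `edgePotential_cubic` applies; the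
    -- diagonal term is removed explicitly through `hN` and `hQ`.
    have h2 := sum_deleteEdge e fun f =>
      (Γ.edgePotential G e (Γ.src f) - Γ.edgePotential G e (Γ.tgt f)) ^ 2 / Γ.length f *
        (Γ.meanVoltage G (Γ.src e) (Γ.tgt e) f + N f / (Γ.length e - Γ.edgeResistance G e))
    have h3 : ∀ f : {f : E // f ≠ e},
        (Γ.deleteEdge e).meanVoltage (Γ.deletedKernel G e) (Γ.src e) (Γ.tgt e) f =
        Γ.meanVoltage G (Γ.src e) (Γ.tgt e) f + N f / (Γ.length e - Γ.edgeResistance G e) :=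
      fun f => by
      simp only [meanVoltage, MetrizedGraph.deleteEdge, deletedKernel, N]
      ring
    have h4 : ∑ f, (Γ.edgePotential G e (Γ.src f) - Γ.edgePotential G e (Γ.tgt f)) ^ 2 /
        Γ.length f *
        (Γ.meanVoltage G (Γ.src e) (Γ.tgt e) f + N f / (Γ.length e - Γ.edgeResistance G e)) =
        ∑ f, (Γ.edgePotential G e (Γ.src f) - Γ.edgePotential G e (Γ.tgt f)) ^ 2 / Γ.length f *
          Γ.meanVoltage G (Γ.src e) (Γ.tgt e) f +
        -Γ.edgeResistance G e ^ 3 / 6 / (Γ.length e - Γ.edgeResistance G e) := by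
      rw [← hG.edgePotential_cubic e, Finset.sum_div, ← Finset.sum_add_distrib]
      exact Finset.sum_congr rfl fun f _ => by ring
    rw [Finset.sum_congr rfl fun f _ => by rw [h3 f], h2, h4, hN, hQ, hG.edgePotential_sub]
    field_simp
    ring
  rw [Finset.sum_congr rfl fun e _ => h1 e, Finset.sum_sub_distrib, hG.sum_sum_meanVoltage,
    totalLength, Finset.sum_div, ← Finset.sum_sub_distrib, ← Finset.sum_sub_distrib]
  refine Finset.sum_congr rfl fun e _ => ?_
  have hL := (Γ.length_pos e).ne'
  field_simp
  ring

end IsGreen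

end MetrizedGraph

/-! ### Piecewise affine functions and uniqueness of voltages. -/

/-- A continuous function on a segment that is affine near every interior point is affine. -/
theorem exists_forall_eq_add_mul_of_locally_affine {a b : ℝ} (hab : a < b) {h : ℝ → ℝ}
    (hc : ContinuousOn h (Icc a b))
    (hloc : ∀ t ∈ Ioo a b, ∃ c : ℝ, ∀ᶠ s in 𝓝 t, h s = h t + c * (s - t)) :
    ∃ c : ℝ, ∀ s ∈ Icc a b, h s = h a + c * (s - a) := by
  have hderiv : ∀ t ∈ Ioo a b, ∀ c : ℝ, (∀ᶠ s in 𝓝 t, h s = h t + c * (s - t)) →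
      HasDerivAt h c t := fun t _ c hct => by
    have h1 : HasDerivAt (fun s => h t + c * (s - t)) c t := by
      simpa using (((hasDerivAt_id t).sub_const t).const_mul c).const_add (h t)
    exact h1.congr_of_eventuallyEq hct
  have hd : ∀ t ∈ Ioo a b, DifferentiableAt ℝ h t := fun t ht => by
    obtain ⟨c, hct⟩ := hloc t ht
    exact (hderiv t ht c hct).differentiableAt
  -- The derivative is locally constant, hence constant on the connected open interval; the mean
  -- value theorem then reaches the end points by continuity.
  have hdd : ∀ t ∈ Ioo a b, HasDerivAt (deriv h) 0 t := fun t ht => by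
    obtain ⟨c, hct⟩ := hloc t ht
    have hev : deriv h =ᶠ[𝓝 t] fun _ => c := by
      filter_upwards [hct.eventually_nhds, isOpen_Ioo.mem_nhds ht] with s hs hsab
      refine (hderiv s hsab c ?_).deriv
      filter_upwards [hs] with r hr
      rw [hr, hs.self_of_nhds]
      ring
    exact (hasDerivAt_const t c).congr_of_eventuallyEq hev
  have hconst : ∀ s ∈ Ioo a b, ∀ t ∈ Ioo a b, deriv h s = deriv h t := fun s hs t ht =>
    isOpen_Ioo.is_const_of_deriv_eq_zero isPreconnected_Ioo
      (fun t ht => (hdd t ht).differentiableAt.differentiableWithinAt)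
      (fun t ht => (hdd t ht).deriv) hs ht
  have hm : (a + b) / 2 ∈ Ioo a b := ⟨by linarith, by linarith⟩
  refine ⟨deriv h ((a + b) / 2), fun s hs => ?_⟩
  rcases hs.1.eq_or_lt with rfl | has
  · simp
  obtain ⟨ξ, hξ, hξs⟩ := exists_deriv_eq_slope h has (hc.mono (Icc_subset_Icc_right hs.2))
    (fun t ht => (hd t ⟨ht.1, ht.2.trans_le hs.2⟩).differentiableWithinAt)
  rw [hconst _ hm _ ⟨hξ.1, hξ.2.trans_le hs.2⟩, hξs, div_mul_cancel₀ _ (sub_pos.2 has).ne']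
  ring

theorem hasDerivWithinAt_of_eventually_affine {h : ℝ → ℝ} {s : Set ℝ} {t c : ℝ}
    (hev : ∀ᶠ r in 𝓝[s] t, h r = h t + c * (r - t)) : HasDerivWithinAt h c s t := by
  have h1 : HasDerivAt (fun r => h t + c * (r - t)) c t := by
    simpa using (((hasDerivAt_id t).sub_const t).const_mul c).const_add (h t)
  exact h1.hasDerivWithinAt.congr_of_eventuallyEq hev (by simp)

namespace MetrizedGraph

variable {V E : Type*} {Γ : MetrizedGraph V E}

theorem pt_of_le {e : E} {t : ℝ} (ht : t ≤ 0) : Γ.pt e t = .vertex (Γ.src e) := by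
  rw [pt, dif_neg fun h => absurd h.1 ht.not_gt, if_pos ht]

theorem pt_of_ge {e : E} {t : ℝ} (ht : Γ.length e ≤ t) : Γ.pt e t = .vertex (Γ.tgt e) := by
  rw [pt, dif_neg fun h => absurd h.2 ht.not_gt, if_neg ((Γ.length_pos e).trans_le ht).not_ge]

theorem pt_of_mem {e : E} {t : ℝ} (ht : t ∈ Ioo 0 (Γ.length e)) :
    Γ.pt e t = .interior e ⟨t, ht⟩ := by
  rw [pt, dif_pos ht]

@[simp] theorem pt_zero (e : E) : Γ.pt e 0 = .vertex (Γ.src e) := pt_of_le le_rfl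

@[simp] theorem pt_length (e : E) : Γ.pt e (Γ.length e) = .vertex (Γ.tgt e) := pt_of_ge le_rfl

@[simp] theorem pt_coe (e : E) (t : Ioo 0 (Γ.length e)) : Γ.pt e t = .interior e t :=
  pt_of_mem t.2

theorem pt_clamp (e : E) (t : ℝ) : Γ.pt e (max 0 (min t (Γ.length e))) = Γ.pt e t := by
  rcases le_total t 0 with h | h
  · rw [max_eq_left ((min_le_left _ _).trans h), pt_of_le h, pt_of_le le_rfl]
  rcases le_total t (Γ.length e) with h' | h'
  · rw [min_eq_left h', max_eq_right h]
  · rw [min_eq_right h', max_eq_right (Γ.length_pos e).le, pt_of_ge h', pt_of_ge le_rfl]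

theorem continuous_pt (e : E) : Continuous (Γ.pt e) :=
  continuous_iff_le_induced.2 <| by
    rw [← continuous_iff_le_induced, continuous_iff_coinduced_le]
    exact le_iSup (fun e => TopologicalSpace.coinduced (Γ.pt e) inferInstance) e

theorem continuous_iff_pt {X : Type*} [TopologicalSpace X] {f : Γ.Point → X} :
    Continuous f ↔ ∀ e, Continuous fun t => f (Γ.pt e t) := by
  rw [continuous_iSup_dom]
  exact forall_congr' fun e => continuous_coinduced_dom

/-- A function is continuous on `Γ` if it is given by continuous functions on the segments. -/
theorem continuous_of_forall_edge {f : Γ.Point → ℝ} (F : E → ℝ → ℝ) (hF : ∀ e, Continuous (F e))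
    (h : ∀ e, ∀ t ∈ Icc 0 (Γ.length e), f (Γ.pt e t) = F e t) : Continuous f := by
  refine continuous_iff_pt.2 fun e => ?_
  have : (fun t => f (Γ.pt e t)) = fun t => F e (max 0 (min t (Γ.length e))) := by
    ext t
    rw [← h e _ ⟨le_max_left _ _, max_le (Γ.length_pos e).le (min_le_right _ _)⟩, pt_clamp]
  rw [this]
  exact (hF e).comp (by fun_prop)

namespace IsPiecewiseAffine

variable {f g : Γ.Point → ℝ}

theorem linearCombination (hf : Γ.IsPiecewiseAffine f) (hg : Γ.IsPiecewiseAffine g) (a b : ℝ) :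
    Γ.IsPiecewiseAffine fun x => a * f x + b * g x := by
  obtain ⟨hfc, S, hS, hfS⟩ := hf
  obtain ⟨hgc, T, hT, hgT⟩ := hg
  refine ⟨by fun_prop, S ∪ T, hS.union hT, fun e t ht hmem => ?_⟩
  rw [mem_union, not_or] at hmem
  obtain ⟨c, hc⟩ := hfS e t ht hmem.1
  obtain ⟨d, hd⟩ := hgT e t ht hmem.2
  refine ⟨a * c + b * d, ?_⟩
  filter_upwards [hc, hd] with s h1 h2
  rw [h1, h2]
  ring

/-- Only finitely many parameters on `e` are exceptional, because `pt` is injective on the open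
segment. Some punctured neighbourhood of `t` avoids them, so one-sided slopes exist everywhere, also
at exceptional points and vertices. -/
theorem exists_affine_near (hf : Γ.IsPiecewiseAffine f) (e : E) (t : ℝ) :
    ∃ δ > 0, ∀ s ∈ Ioo 0 (Γ.length e), s ≠ t → |s - t| < δ →
      ∃ a : ℝ, ∀ᶠ r in 𝓝 s, f (Γ.pt e r) = f (Γ.pt e s) + a * (r - s) := by
  obtain ⟨-, S, hS, hfS⟩ := hf
  let F : Set ℝ := Subtype.val '' ((fun s : Ioo 0 (Γ.length e) => Γ.pt e s) ⁻¹' S) \ {t}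
  have hF : F.Finite := by
    refine ((hS.preimage fun s _ s' _ h => ?_).image _).sdiff
    simpa using h
  obtain ⟨δ, hδ, hball⟩ := Metric.isOpen_iff.1 hF.isClosed.isOpen_compl t (by simp [F])
  refine ⟨δ, hδ, fun s hs hst hsδ => hfS e s hs fun hmem => ?_⟩
  exact hball (show s ∈ Metric.ball t δ by rwa [Metric.mem_ball, Real.dist_eq])
    ⟨⟨⟨s, hs⟩, hmem, rfl⟩, hst⟩

theorem exists_right (hf : Γ.IsPiecewiseAffine f) (e : E) {t : ℝ} (ht : t ∈ Ico 0 (Γ.length e)) :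
    ∃ a : ℝ, ∀ᶠ s in 𝓝[≥] t, f (Γ.pt e s) = f (Γ.pt e t) + a * (s - t) := by
  obtain ⟨δ, hδ, h⟩ := hf.exists_affine_near e t
  obtain ⟨b, htb, hb⟩ := exists_between (lt_min ht.2 (lt_add_of_pos_right t hδ))
  rw [lt_min_iff] at hb
  obtain ⟨a, ha⟩ := exists_forall_eq_add_mul_of_locally_affine (h := fun s => f (Γ.pt e s)) htb
    (hf.1.comp (continuous_pt e)).continuousOn fun s hs =>
      h s ⟨ht.1.trans_lt hs.1, hs.2.trans hb.1⟩ hs.1.ne' (by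
        rw [abs_of_pos (sub_pos.2 hs.1)]; linarith [hs.2])
  exact ⟨a, eventually_of_mem (Icc_mem_nhdsGE htb) ha⟩

theorem exists_left (hf : Γ.IsPiecewiseAffine f) (e : E) {t : ℝ} (ht : t ∈ Ioc 0 (Γ.length e)) :
    ∃ a : ℝ, ∀ᶠ s in 𝓝[≤] t, f (Γ.pt e s) = f (Γ.pt e t) + a * (s - t) := by
  obtain ⟨δ, hδ, h⟩ := hf.exists_affine_near e t
  obtain ⟨b, hb, hbt⟩ := exists_between (max_lt ht.1 (sub_lt_self t hδ))
  rw [max_lt_iff] at hb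
  obtain ⟨a, ha⟩ := exists_forall_eq_add_mul_of_locally_affine (h := fun s => f (Γ.pt e s)) hbt
    (hf.1.comp (continuous_pt e)).continuousOn fun s hs =>
      h s ⟨hb.1.trans hs.1, hs.2.trans_le ht.2⟩ hs.2.ne (by
        rw [abs_of_neg (sub_neg.2 hs.2)]; linarith [hs.1])
  refine ⟨a, eventually_of_mem (Icc_mem_nhdsLE hbt) fun s hs => ?_⟩
  have h1 := ha s hs
  have h2 := ha t ⟨hbt.le, le_rfl⟩
  rw [h1, h2]
  ring

variable [Fintype E]

/-- `derivWithin` is additive only where derivatives exist, which the one-sided slopes guarantee. -/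
theorem laplacianMass_linearCombination (hf : Γ.IsPiecewiseAffine f)
    (hg : Γ.IsPiecewiseAffine g) (a b : ℝ) (x : Γ.Point) :
    Γ.laplacianMass (fun x => a * f x + b * g x) x =
      a * Γ.laplacianMass f x + b * Γ.laplacianMass g x := by
  have hr : ∀ e, ∀ t ∈ Ico 0 (Γ.length e),
      derivWithin (fun s => a * f (Γ.pt e s) + b * g (Γ.pt e s)) (Ici t) t =
      a * derivWithin (fun s => f (Γ.pt e s)) (Ici t) t +
        b * derivWithin (fun s => g (Γ.pt e s)) (Ici t) t := fun e t ht => by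
    obtain ⟨c, hc⟩ := hf.exists_right e ht
    obtain ⟨d, hd⟩ := hg.exists_right e ht
    have hc := hasDerivWithinAt_of_eventually_affine (h := fun s => f (Γ.pt e s)) hc
    have hd := hasDerivWithinAt_of_eventually_affine (h := fun s => g (Γ.pt e s)) hd
    rw [hc.derivWithin (uniqueDiffWithinAt_Ici t), hd.derivWithin (uniqueDiffWithinAt_Ici t)]
    exact ((hc.const_mul a).fun_add (hd.const_mul b)).derivWithin (uniqueDiffWithinAt_Ici t)
  have hl : ∀ e, ∀ t ∈ Ioc 0 (Γ.length e),
      derivWithin (fun s => a * f (Γ.pt e s) + b * g (Γ.pt e s)) (Iic t) t =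
      a * derivWithin (fun s => f (Γ.pt e s)) (Iic t) t +
        b * derivWithin (fun s => g (Γ.pt e s)) (Iic t) t := fun e t ht => by
    obtain ⟨c, hc⟩ := hf.exists_left e ht
    obtain ⟨d, hd⟩ := hg.exists_left e ht
    have hc := hasDerivWithinAt_of_eventually_affine (h := fun s => f (Γ.pt e s)) hc
    have hd := hasDerivWithinAt_of_eventually_affine (h := fun s => g (Γ.pt e s)) hd
    rw [hc.derivWithin (uniqueDiffWithinAt_Iic t), hd.derivWithin (uniqueDiffWithinAt_Iic t)]
    exact ((hc.const_mul a).fun_add (hd.const_mul b)).derivWithin (uniqueDiffWithinAt_Iic t)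
  cases x with
  | vertex v =>
    simp only [laplacianMass, outwardSlopeSum, hr _ 0 ⟨le_rfl, Γ.length_pos _⟩,
      hl _ _ ⟨Γ.length_pos _, le_rfl⟩, ← Finset.sum_neg_distrib, Finset.mul_sum,
      ← Finset.sum_add_distrib]
    refine Finset.sum_congr rfl fun e _ => ?_
    split_ifs <;> ring
  | interior e t =>
    simp only [laplacianMass, outwardSlopeSum, hr _ t.1 ⟨t.2.1.le, t.2.2⟩,
      hl _ t.1 ⟨t.2.1, t.2.2.le⟩]
    ring

end IsPiecewiseAffine

theorem laplacianMass_interior [Fintype E] {f : Γ.Point → ℝ} {e : E} {t : Ioo 0 (Γ.length e)}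
    {a b : ℝ}
    (ha : ∀ᶠ s in 𝓝[≥] (t : ℝ), f (Γ.pt e s) = f (Γ.pt e t) + a * (s - t))
    (hb : ∀ᶠ s in 𝓝[≤] (t : ℝ), f (Γ.pt e s) = f (Γ.pt e t) + b * (s - t)) :
    Γ.laplacianMass f (.interior e t) = b - a := by
  rw [laplacianMass, outwardSlopeSum,
    (hasDerivWithinAt_of_eventually_affine (h := fun s => f (Γ.pt e s)) ha).derivWithin
      (uniqueDiffWithinAt_Ici _),
    (hasDerivWithinAt_of_eventually_affine (h := fun s => f (Γ.pt e s)) hb).derivWithin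
      (uniqueDiffWithinAt_Iic _)]
  ring

open Classical in
theorem laplacianMass_vertex [Fintype E] {f : Γ.Point → ℝ} {a b : E → ℝ}
    (ha : ∀ e, ∀ᶠ s in 𝓝[≥] 0, f (Γ.pt e s) = f (Γ.pt e 0) + a e * s)
    (hb : ∀ e, ∀ᶠ s in 𝓝[≤] (Γ.length e),
      f (Γ.pt e s) = f (Γ.pt e (Γ.length e)) + b e * (s - Γ.length e)) (v : V) :
    Γ.laplacianMass f (.vertex v) =
      ∑ e, ((if Γ.tgt e = v then b e else 0) - (if Γ.src e = v then a e else 0)) := by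
  rw [laplacianMass, outwardSlopeSum, ← Finset.sum_neg_distrib]
  refine Finset.sum_congr rfl fun e _ => ?_
  have ha' : ∀ᶠ s in 𝓝[≥] 0, f (Γ.pt e s) = f (Γ.pt e 0) + a e * (s - 0) := by
    simpa only [sub_zero] using ha e
  rw [(hasDerivWithinAt_of_eventually_affine (h := fun s => f (Γ.pt e s)) ha').derivWithin
      (uniqueDiffWithinAt_Ici _),
    (hasDerivWithinAt_of_eventually_affine (h := fun s => f (Γ.pt e s)) (hb e)).derivWithin
      (uniqueDiffWithinAt_Iic _)]
  split_ifs <;> ring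

/-- The Laplacian at the vertices of a function that is affine on the edges. -/
theorem laplacianMass_vertex_of_affine [Fintype E] {f : Γ.Point → ℝ}
    (h : ∀ e, ∀ t ∈ Icc 0 (Γ.length e), f (Γ.pt e t) = f (.vertex (Γ.src e)) +
      (f (.vertex (Γ.tgt e)) - f (.vertex (Γ.src e))) / Γ.length e * t) (v : V) :
    Γ.laplacianMass f (.vertex v) = Γ.vertexLaplacian (fun v => f (.vertex v)) v := by
  classical
  rw [laplacianMass_vertex
    (a := fun e => (f (.vertex (Γ.tgt e)) - f (.vertex (Γ.src e))) / Γ.length e)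
    (b := fun e => (f (.vertex (Γ.tgt e)) - f (.vertex (Γ.src e))) / Γ.length e)]
  · rw [vertexLaplacian]
    refine Finset.sum_congr rfl fun e _ => ?_
    split_ifs <;> first | contradiction | ring
  · intro e
    filter_upwards [Icc_mem_nhdsGE (Γ.length_pos e)] with s hs
    rw [h e s hs, pt_zero]
  · intro e
    filter_upwards [Icc_mem_nhdsLE (Γ.length_pos e)] with s hs
    have hL := (Γ.length_pos e).ne'
    rw [h e s hs, pt_length]
    field_simp
    ring

/-- A harmonic function on a connected metrized graph is constant. -/
theorem Connected.eq_of_laplacianMass_eq_zero [Fintype E] [Finite V] (hΓ : Γ.Connected)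
    {f : Γ.Point → ℝ} (hf : Γ.IsPiecewiseAffine f) (h : ∀ x, Γ.laplacianMass f x = 0)
    (x y : Γ.Point) : f x = f y := by
  cases nonempty_fintype V
  have hloc : ∀ e, ∀ t ∈ Ioo 0 (Γ.length e),
      ∃ c : ℝ, ∀ᶠ s in 𝓝 t, f (Γ.pt e s) = f (Γ.pt e t) + c * (s - t) := fun e t ht => by
    obtain ⟨a, ha⟩ := hf.exists_right e (Ioo_subset_Ico_self ht)
    obtain ⟨b, hb⟩ := hf.exists_left e (Ioo_subset_Ioc_self ht)
    have := h (.interior e ⟨t, ht⟩)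
    -- Zero mass makes the left and right slopes agree. The function is thus affine on each edge,
    -- and the claim becomes one about the vertex Laplacian.
    rw [laplacianMass_interior ha hb, sub_eq_zero] at this
    subst this
    refine ⟨b, ?_⟩
    rw [← nhdsLE_sup_nhdsGE, eventually_sup]
    exact ⟨hb, ha⟩
  have haff : ∀ e, ∀ t ∈ Icc 0 (Γ.length e), f (Γ.pt e t) = f (.vertex (Γ.src e)) +
      (f (.vertex (Γ.tgt e)) - f (.vertex (Γ.src e))) / Γ.length e * t := fun e => by
    have hL := Γ.length_pos e
    obtain ⟨c, hc⟩ := exists_forall_eq_add_mul_of_locally_affine (h := fun s => f (Γ.pt e s)) hL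
      (hf.1.comp (continuous_pt e)).continuousOn (hloc e)
    intro t ht
    have h1 := hc t ht
    have h2 := hc _ ⟨hL.le, le_rfl⟩
    simp only [pt_zero, pt_length, sub_zero] at h1 h2
    rw [h1, h2, add_sub_cancel_left, mul_div_cancel_right₀ _ hL.ne']
  have hvert := hΓ.eq_of_vertexLaplacian_eq_zero (φ := fun v => f (.vertex v))
    fun v => by rw [← laplacianMass_vertex_of_affine haff, h]
  have key : ∀ x : Γ.Point, ∃ v, f x = f (.vertex v) := fun x => by
    cases x with
    | vertex v => exact ⟨v, rfl⟩
    | interior e t =>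
      refine ⟨Γ.src e, ?_⟩
      rw [← pt_coe, haff e t ⟨t.2.1.le, t.2.2.le⟩, hvert (Γ.tgt e) (Γ.src e)]
      ring
  obtain ⟨u, hu⟩ := key x
  obtain ⟨v, hv⟩ := key y
  rw [hu, hv]
  exact hvert u v

theorem IsVoltage.unique [Fintype E] [Finite V] (hΓ : Γ.Connected) {z y : Γ.Point}
    {f g : Γ.Point → ℝ} (hf : Γ.IsVoltage z y f) (hg : Γ.IsVoltage z y g) : f = g := by
  ext x
  have h := hΓ.eq_of_laplacianMass_eq_zero
    (hf.piecewiseAffine.linearCombination hg.piecewiseAffine 1 (-1)) (fun w => by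
      rw [hf.piecewiseAffine.laplacianMass_linearCombination hg.piecewiseAffine, hf.laplacian,
        hg.laplacian]
      ring) x z
  rw [hf.ground, hg.ground] at h
  linarith

/-- Uniqueness makes the choice of `Classical.epsilon` immaterial. -/
theorem IsVoltage.voltage_eq [Fintype E] [Finite V] (hΓ : Γ.Connected) {z y : Γ.Point}
    {f : Γ.Point → ℝ} (hf : Γ.IsVoltage z y f) (x : Γ.Point) : Γ.voltage z x y = f x := by
  have := Classical.epsilon_spec (p := fun f : Γ.Point → ℝ => Γ.IsVoltage z y f) ⟨f, hf⟩
  rw [voltage, this.unique hΓ hf]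

end MetrizedGraph

/-! ### The Green kernel on all points and existence of voltages. -/

namespace MetrizedGraph

variable {V E : Type*} {Γ : MetrizedGraph V E}

/-- The extension of a function on the vertices that is affine on every edge. -/
def interp (Γ : MetrizedGraph V E) (φ : V → ℝ) : Γ.Point → ℝ
  | .vertex v => φ v
  | .interior e t => φ (Γ.src e) + (φ (Γ.tgt e) - φ (Γ.src e)) / Γ.length e * t

open Classical in
/-- The sum over the edges of the Green kernels of the segments with vanishing boundary values. -/
def bridge (Γ : MetrizedGraph V E) : Γ.Point → Γ.Point → ℝ
  | .interior e t, .interior e' t' =>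
    if e = e' then min (t : ℝ) t' * (1 - max (t : ℝ) t' / Γ.length e) else 0
  | _, _ => 0

theorem interp_vertex (φ : V → ℝ) (v : V) : Γ.interp φ (.vertex v) = φ v := rfl

theorem interp_pt (φ : V → ℝ) {e : E} {t : ℝ} (ht : t ∈ Icc 0 (Γ.length e)) :
    Γ.interp φ (Γ.pt e t) = φ (Γ.src e) + (φ (Γ.tgt e) - φ (Γ.src e)) / Γ.length e * t := by
  rcases ht.1.eq_or_lt with rfl | h0
  · simp [interp]
  rcases ht.2.eq_or_lt with rfl | h1
  · rw [pt_length, interp, div_mul_cancel₀ _ (Γ.length_pos e).ne']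
    ring
  · rw [pt_of_mem ⟨h0, h1⟩, interp]

/-- The value of `interp φ` at a point is a convex combination of two values of `φ`. -/
theorem exists_interp_eq (x : Γ.Point) : ∃ (p q : V) (a : ℝ), 0 ≤ a ∧ a ≤ 1 ∧
    ∀ φ, Γ.interp φ x = (1 - a) * φ p + a * φ q := by
  cases x with
  | vertex v => exact ⟨v, v, 0, le_rfl, zero_le_one, fun φ => by simp [interp]⟩
  | interior e t =>
    refine ⟨Γ.src e, Γ.tgt e, t / Γ.length e, div_nonneg t.2.1.le (Γ.length_pos e).le,
      (div_le_one (Γ.length_pos e)).2 t.2.2.le, fun φ => ?_⟩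
    rw [interp]
    ring

theorem interp_const (c : ℝ) (x : Γ.Point) : Γ.interp (fun _ => c) x = c := by
  obtain ⟨p, q, a, -, -, h⟩ := exists_interp_eq x
  rw [h]
  ring

theorem interp_comm (G : V → V → ℝ) (hG : ∀ u v, G u v = G v u) (x y : Γ.Point) :
    Γ.interp (fun u => Γ.interp (G u) y) x = Γ.interp (fun u => Γ.interp (G u) x) y := by
  obtain ⟨p, q, a, -, -, h⟩ := exists_interp_eq x
  obtain ⟨p', q', a', -, -, h'⟩ := exists_interp_eq y
  simp only [h, h']
  rw [hG p p', hG p q', hG q p', hG q q']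
  ring

theorem abs_interp_le {φ : V → ℝ} {C : ℝ} (hφ : ∀ v, |φ v| ≤ C) (x : Γ.Point) :
    |Γ.interp φ x| ≤ C := by
  obtain ⟨p, q, a, h0, h1, h⟩ := exists_interp_eq x
  have hp := abs_le.1 (hφ p)
  have hq := abs_le.1 (hφ q)
  rw [h, abs_le]
  constructor <;> nlinarith

@[simp] theorem bridge_vertex_right (x : Γ.Point) (v : V) : Γ.bridge x (.vertex v) = 0 := by
  cases x <;> rfl

@[simp] theorem bridge_vertex_left (x : Γ.Point) (v : V) : Γ.bridge (.vertex v) x = 0 := by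
  cases x <;> rfl

theorem bridge_comm (x y : Γ.Point) : Γ.bridge x y = Γ.bridge y x := by
  rcases x with _ | ⟨e, t⟩ <;> rcases y with _ | ⟨e', t'⟩ <;> try simp
  rw [bridge, bridge]
  by_cases h : e = e'
  · subst h
    rw [if_pos rfl, if_pos rfl, min_comm, max_comm]
  · rw [if_neg h, if_neg (Ne.symm h)]

open Classical in
theorem bridge_pt_interior {e e' : E} {t : ℝ} (ht : t ∈ Icc 0 (Γ.length e))
    (t' : Ioo 0 (Γ.length e')) : Γ.bridge (Γ.pt e t) (.interior e' t') =
      if e = e' then min t t' * (1 - max t t' / Γ.length e) else 0 := by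
  rcases ht.1.eq_or_lt with rfl | h0
  · rw [pt_zero, bridge_vertex_left, min_eq_left t'.2.1.le, zero_mul, ite_self]
  rcases ht.2.eq_or_lt with rfl | h1
  · rw [pt_length, bridge_vertex_left]
    split_ifs with h
    · subst h
      rw [max_eq_left t'.2.2.le, div_self (Γ.length_pos e).ne', sub_self, mul_zero]
    · rfl
  · rw [pt_of_mem ⟨h0, h1⟩, bridge]

theorem bridge_nonneg (x y : Γ.Point) : 0 ≤ Γ.bridge x y := by
  rcases x with _ | ⟨e, t⟩ <;> rcases y with _ | ⟨e', t'⟩ <;> try simp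
  rw [bridge]
  split_ifs with h
  · subst h
    exact mul_nonneg (le_min t.2.1.le t'.2.1.le)
      (sub_nonneg.2 ((div_le_one (Γ.length_pos e)).2 (max_le t.2.2.le t'.2.2.le)))
  · exact le_rfl

theorem bridge_le {C : ℝ} (hC : ∀ e, Γ.length e ≤ C) (hC0 : 0 ≤ C) (x y : Γ.Point) :
    Γ.bridge x y ≤ C := by
  rcases x with _ | ⟨e, t⟩ <;> rcases y with _ | ⟨e', t'⟩ <;> try simpa
  rw [bridge]
  split_ifs with h
  · subst h
    have h1 : 0 ≤ max (t : ℝ) t' / Γ.length e :=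
      div_nonneg (t.2.1.le.trans (le_max_left _ _)) (Γ.length_pos e).le
    have h2 : min (t : ℝ) t' ≤ C := (min_le_left _ _).trans (t.2.2.le.trans (hC e))
    have h3 : 0 ≤ min (t : ℝ) t' := le_min t.2.1.le t'.2.1.le
    nlinarith
  · exact hC0

theorem isPiecewiseAffine_interp (φ : V → ℝ) : Γ.IsPiecewiseAffine (Γ.interp φ) := by
  refine ⟨continuous_of_forall_edge
    (fun e t => φ (Γ.src e) + (φ (Γ.tgt e) - φ (Γ.src e)) / Γ.length e * t)
    (fun e => by fun_prop) fun e t ht => interp_pt φ ht, ∅, finite_empty, fun e t ht _ =>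
    ⟨(φ (Γ.tgt e) - φ (Γ.src e)) / Γ.length e, ?_⟩⟩
  filter_upwards [isOpen_Ioo.mem_nhds ht] with s hs
  rw [interp_pt φ (Ioo_subset_Icc_self hs), interp_pt φ (Ioo_subset_Icc_self ht)]
  ring

theorem isPiecewiseAffine_const (c : ℝ) : Γ.IsPiecewiseAffine fun _ => c := by
  rw [show (fun _ => c) = Γ.interp fun _ => c from funext fun x => (interp_const c x).symm]
  exact isPiecewiseAffine_interp _

theorem bridge_pt_of_ne {e e' : E} (h : e ≠ e') (t : ℝ) (t' : Ioo 0 (Γ.length e')) :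
    Γ.bridge (Γ.pt e t) (.interior e' t') = 0 := by
  classical
  rw [← pt_clamp, bridge_pt_interior ⟨le_max_left _ _, max_le (Γ.length_pos e).le
    (min_le_right _ _)⟩, if_neg h]

theorem bridge_pt_of_le {e : E} {t : ℝ} {t' : Ioo 0 (Γ.length e)} (h0 : 0 ≤ t) (h : t ≤ t') :
    Γ.bridge (Γ.pt e t) (.interior e t') = t * (1 - t' / Γ.length e) := by
  classical
  rw [bridge_pt_interior ⟨h0, h.trans t'.2.2.le⟩, if_pos rfl, min_eq_left h, max_eq_right h]

theorem bridge_pt_of_ge {e : E} {t : ℝ} {t' : Ioo 0 (Γ.length e)} (h0 : t ≤ Γ.length e)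
    (h : t' ≤ t) : Γ.bridge (Γ.pt e t) (.interior e t') = t' * (1 - t / Γ.length e) := by
  classical
  rw [bridge_pt_interior ⟨t'.2.1.le.trans h, h0⟩, if_pos rfl, min_eq_right h, max_eq_left h]

theorem bridge_eventually_right {e : E} {t : ℝ} {t' : Ioo 0 (Γ.length e)} (h0 : 0 ≤ t)
    (h : t < t') : ∀ᶠ s in 𝓝[≥] t, Γ.bridge (Γ.pt e s) (.interior e t') =
      Γ.bridge (Γ.pt e t) (.interior e t') + (1 - t' / Γ.length e) * (s - t) := by
  filter_upwards [Icc_mem_nhdsGE h] with s hs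
  rw [bridge_pt_of_le (h0.trans hs.1) hs.2, bridge_pt_of_le h0 h.le]
  ring

theorem bridge_eventually_right' {e : E} {t : ℝ} {t' : Ioo 0 (Γ.length e)} (h0 : t < Γ.length e)
    (h : t' ≤ t) : ∀ᶠ s in 𝓝[≥] t, Γ.bridge (Γ.pt e s) (.interior e t') =
      Γ.bridge (Γ.pt e t) (.interior e t') + -(t' / Γ.length e) * (s - t) := by
  filter_upwards [Icc_mem_nhdsGE h0] with s hs
  rw [bridge_pt_of_ge hs.2 (h.trans hs.1), bridge_pt_of_ge h0.le h]
  ring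

theorem bridge_eventually_left {e : E} {t : ℝ} {t' : Ioo 0 (Γ.length e)} (h0 : 0 < t)
    (h : t ≤ t') : ∀ᶠ s in 𝓝[≤] t, Γ.bridge (Γ.pt e s) (.interior e t') =
      Γ.bridge (Γ.pt e t) (.interior e t') + (1 - t' / Γ.length e) * (s - t) := by
  filter_upwards [Icc_mem_nhdsLE h0] with s hs
  rw [bridge_pt_of_le hs.1 (hs.2.trans h), bridge_pt_of_le h0.le h]
  ring

theorem bridge_eventually_left' {e : E} {t : ℝ} {t' : Ioo 0 (Γ.length e)} (h0 : t ≤ Γ.length e)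
    (h : t' < t) : ∀ᶠ s in 𝓝[≤] t, Γ.bridge (Γ.pt e s) (.interior e t') =
      Γ.bridge (Γ.pt e t) (.interior e t') + -(t' / Γ.length e) * (s - t) := by
  filter_upwards [Icc_mem_nhdsLE h] with s hs
  rw [bridge_pt_of_ge (hs.2.trans h0) hs.1, bridge_pt_of_ge h0 h.le]
  ring

theorem isPiecewiseAffine_bridge (y : Γ.Point) : Γ.IsPiecewiseAffine fun x => Γ.bridge x y := by
  classical
  cases y with
  | vertex v => simpa using Γ.isPiecewiseAffine_const 0
  | interior e' t' =>
    refine ⟨continuous_of_forall_edge (fun e t =>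
        if e = e' then min t t' * (1 - max t t' / Γ.length e) else 0)
      (fun e => by split_ifs <;> fun_prop) (fun e t ht => bridge_pt_interior ht t'),
      {.interior e' t'}, finite_singleton _, fun e t ht hne => ?_⟩
    by_cases h : e = e'
    · subst h
      have hne' : t ≠ t' := fun h => hne (by rw [h, pt_coe]; rfl)
      rcases hne'.lt_or_gt with h | h
      · refine ⟨1 - t' / Γ.length e, ?_⟩
        rw [← nhdsLE_sup_nhdsGE, eventually_sup]
        exact ⟨bridge_eventually_left ht.1 h.le, bridge_eventually_right ht.1.le h⟩
      · refine ⟨-(t' / Γ.length e), ?_⟩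
        rw [← nhdsLE_sup_nhdsGE, eventually_sup]
        exact ⟨bridge_eventually_left' ht.2.le h, bridge_eventually_right' ht.2 h.le⟩
    · exact ⟨0, by simp [bridge_pt_of_ne h]⟩

/-- The extension of a Green kernel from the vertices to all points. -/
def pointKernel (Γ : MetrizedGraph V E) (G : V → V → ℝ) (x y : Γ.Point) : ℝ :=
  Γ.interp (fun u => Γ.interp (G u) y) x + Γ.bridge x y

theorem isPiecewiseAffine_pointKernel (G : V → V → ℝ) (y : Γ.Point) :
    Γ.IsPiecewiseAffine fun x => Γ.pointKernel G x y := by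
  simpa [pointKernel] using (Γ.isPiecewiseAffine_interp fun u => Γ.interp (G u) y).linearCombination
    (Γ.isPiecewiseAffine_bridge y) 1 1

theorem pointKernel_vertex (G : V → V → ℝ) (u v : V) :
    Γ.pointKernel G (.vertex u) (.vertex v) = G u v := by
  simp [pointKernel, interp]

variable [Fintype E]

theorem laplacianMass_interp_interior (φ : V → ℝ) (e : E) (t : Ioo 0 (Γ.length e)) :
    Γ.laplacianMass (Γ.interp φ) (.interior e t) = 0 := by
  have h : ∀ᶠ s in 𝓝 (t : ℝ), Γ.interp φ (Γ.pt e s) =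
      Γ.interp φ (Γ.pt e t) + (φ (Γ.tgt e) - φ (Γ.src e)) / Γ.length e * (s - t) := by
    filter_upwards [isOpen_Ioo.mem_nhds t.2] with s hs
    rw [interp_pt φ (Ioo_subset_Icc_self hs), interp_pt φ (Ioo_subset_Icc_self t.2)]
    ring
  rw [laplacianMass_interior (h.filter_mono nhdsWithin_le_nhds)
    (h.filter_mono nhdsWithin_le_nhds), sub_self]

theorem laplacianMass_interp_vertex (φ : V → ℝ) (v : V) :
    Γ.laplacianMass (Γ.interp φ) (.vertex v) = Γ.vertexLaplacian φ v :=
  laplacianMass_vertex_of_affine (fun _ _ ht => interp_pt φ ht) v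

open Classical in
theorem laplacianMass_bridge_interior (y : Γ.Point) (e : E) (t : Ioo 0 (Γ.length e)) :
    Γ.laplacianMass (fun x => Γ.bridge x y) (.interior e t) =
      if .interior e t = y then 1 else 0 := by
  cases y with
  | vertex v =>
    have : (fun x => Γ.bridge x (.vertex v)) = Γ.interp fun _ => 0 := by
      ext x; rw [bridge_vertex_right, interp_const]
    rw [this, laplacianMass_interp_interior, if_neg (by simp)]
  | interior e' t' =>
    by_cases h : e = e'
    · subst h
      rcases lt_trichotomy t t' with h | h | h
      · rw [if_neg (by simpa using h.ne), laplacianMass_interior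
          (bridge_eventually_right t.2.1.le h) (bridge_eventually_left t.2.1 (le_of_lt h)),
          sub_self]
      · rw [if_pos (by rw [h]), laplacianMass_interior
          (bridge_eventually_right' t.2.2 h.ge) (bridge_eventually_left t.2.1 h.le)]
        ring
      · rw [if_neg (by simpa using h.ne'), laplacianMass_interior
          (bridge_eventually_right' t.2.2 (le_of_lt h)) (bridge_eventually_left' t.2.2.le h),
          sub_self]
    · rw [if_neg (by simp [h]), laplacianMass_interior (a := 0) (b := 0), sub_self] <;>
        simp only [bridge_pt_of_ne h, zero_mul, add_zero, eventually_true]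

-- For `y` inside an edge, the Dirichlet kernel leaves negative masses at the ends of that edge,
-- namely the barycentric weights of `y`; the interpolated indicator records them.
open Classical in
theorem laplacianMass_bridge_vertex (y : Γ.Point) (v : V) :
    Γ.laplacianMass (fun x => Γ.bridge x y) (.vertex v) =
      (if .vertex v = y then 1 else 0) - Γ.interp (fun w => if w = v then 1 else 0) y := by
  cases y with
  | vertex w =>
    have : (fun x => Γ.bridge x (.vertex w)) = Γ.interp fun _ => 0 := by
      ext x; rw [bridge_vertex_right, interp_const]
    rw [this, laplacianMass_interp_vertex]
    simp [vertexLaplacian, interp, eq_comm]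
  | interior e' t' =>
    rw [laplacianMass_vertex (a := fun e => if e = e' then 1 - t' / Γ.length e else 0)
      (b := fun e => if e = e' then -(t' / Γ.length e) else 0), Finset.sum_eq_single e']
    · rw [if_pos rfl, if_pos rfl, interp,
        if_neg (by simp : ¬ (Point.vertex v : Γ.Point) = .interior e' t')]
      split_ifs <;> ring
    · intro e _ h
      simp [h]
    · simp
    · intro e
      by_cases h : e = e'
      · subst h
        have := bridge_eventually_right le_rfl t'.2.1
        simpa using this
      · simp [h, bridge_pt_of_ne h]
    · intro e
      by_cases h : e = e'
      · subst h
        have := bridge_eventually_left' le_rfl t'.2.2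
        simpa using this
      · simp [h, bridge_pt_of_ne h]

namespace IsGreen

variable {o : V} {G : V → V → ℝ}

theorem pointKernel_comm (hG : Γ.IsGreen o G) (x y : Γ.Point) :
    Γ.pointKernel G x y = Γ.pointKernel G y x := by
  rw [pointKernel, pointKernel, interp_comm G hG.symm, bridge_comm]

-- The end masses left by `bridge` cancel against the Laplacian of the interpolated kernel, leaving
-- δ_y - δ_o.
open Classical in
theorem laplacianMass_pointKernel (hG : Γ.IsGreen o G) (x y : Γ.Point) :
    Γ.laplacianMass (fun x => Γ.pointKernel G x y) x =
      (if x = y then 1 else 0) - (if x = .vertex o then 1 else 0) := by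
  have h1 := (Γ.isPiecewiseAffine_interp fun u =>
    Γ.interp (G u) y).laplacianMass_linearCombination (Γ.isPiecewiseAffine_bridge y) 1 1 x
  simp only [one_mul] at h1
  refine h1.trans ?_
  cases x with
  | vertex v =>
    rw [laplacianMass_interp_vertex, laplacianMass_bridge_vertex]
    have h2 : Γ.vertexLaplacian (fun u => Γ.interp (G u) y) v =
        Γ.interp (fun w => if w = v then 1 else 0) y - (if o = v then 1 else 0) := by
      obtain ⟨p, q, a, -, -, h⟩ := exists_interp_eq y
      have hp := hG.vertexLaplacian_eq v p
      have hq := hG.vertexLaplacian_eq v q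
      have : Γ.vertexLaplacian (fun u => Γ.interp (G u) y) v =
          (1 - a) * Γ.vertexLaplacian (fun u => G u p) v +
            a * Γ.vertexLaplacian (fun u => G u q) v := by
        simp only [vertexLaplacian, Finset.mul_sum, ← Finset.sum_add_distrib, h]
        exact Finset.sum_congr rfl fun e _ => by ring
      rw [this, hp, hq, h]
      ring
    rw [h2]
    simp only [Point.vertex.injEq, eq_comm]
    ring
  | interior e t =>
    rw [laplacianMass_interp_interior, laplacianMass_bridge_interior]
    simp

/-- In the difference of the columns at `y` and `z` the masses at `o` cancel; the constant
normalizes the value at `z`. -/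
theorem isVoltage (hG : Γ.IsGreen o G) (z y : Γ.Point) :
    Γ.IsVoltage z y fun x => Γ.pointKernel G x y - Γ.pointKernel G x z -
      Γ.pointKernel G z y + Γ.pointKernel G z z := by
  have hy := Γ.isPiecewiseAffine_pointKernel G y
  have hz := Γ.isPiecewiseAffine_pointKernel G z
  have hc := Γ.isPiecewiseAffine_const (Γ.pointKernel G z z - Γ.pointKernel G z y)
  have heq : (fun x => Γ.pointKernel G x y - Γ.pointKernel G x z -
      Γ.pointKernel G z y + Γ.pointKernel G z z) = fun x =>
      1 * (1 * Γ.pointKernel G x y + -1 * Γ.pointKernel G x z) +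
        1 * (Γ.pointKernel G z z - Γ.pointKernel G z y) := by
    ext x; ring
  have hc0 : ∀ x, Γ.laplacianMass (fun _ => Γ.pointKernel G z z - Γ.pointKernel G z y) x = 0 :=
    fun x => by
      rw [laplacianMass, neg_eq_zero]
      cases x <;> simp [outwardSlopeSum]
  refine ⟨?_, fun x => ?_, by ring⟩
  · rw [heq]
    exact (hy.linearCombination hz 1 (-1)).linearCombination hc 1 1
  · rw [heq, (hy.linearCombination hz 1 (-1)).laplacianMass_linearCombination hc,
      hy.laplacianMass_linearCombination hz, hG.laplacianMass_pointKernel,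
      hG.laplacianMass_pointKernel, hc0]
    ring

variable [Finite V]

theorem voltage_eq (hG : Γ.IsGreen o G) (hΓ : Γ.Connected) (z x y : Γ.Point) :
    Γ.voltage z x y = Γ.pointKernel G x y - Γ.pointKernel G x z -
      Γ.pointKernel G z y + Γ.pointKernel G z z :=
  (hG.isVoltage z y).voltage_eq hΓ x

theorem resistance_eq (hG : Γ.IsGreen o G) (hΓ : Γ.Connected) (x y : Γ.Point) :
    Γ.resistance x y = Γ.pointKernel G x x + Γ.pointKernel G y y - 2 * Γ.pointKernel G x y := by
  rw [resistance, hG.voltage_eq hΓ, hG.pointKernel_comm y x]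
  ring

end IsGreen

end MetrizedGraph

/-! ### The integrals A in terms of the Green kernel. -/

theorem integral_quadratic (a b c L : ℝ) :
    ∫ t in (0 : ℝ)..L, (a + b * t + c * t ^ 2) = a * L + b * L ^ 2 / 2 + c * L ^ 3 / 3 := by
  rw [intervalIntegral.integral_add, intervalIntegral.integral_add,
    intervalIntegral.integral_const_mul, intervalIntegral.integral_const_mul,
    intervalIntegral.integral_const, integral_id, integral_pow]
  · simp
    ring
  all_goals exact Continuous.intervalIntegrable (by fun_prop) _ _

namespace MetrizedGraph

variable {V E : Type*} {Γ : MetrizedGraph V E}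

theorem pointKernel_vertex_right (G : V → V → ℝ) (x : Γ.Point) (v : V) :
    Γ.pointKernel G x (.vertex v) = Γ.interp (fun u => G u v) x := by
  simp [pointKernel, interp_vertex]

theorem bridge_pt_self {e : E} {t : ℝ} (ht : t ∈ Icc 0 (Γ.length e)) :
    Γ.bridge (Γ.pt e t) (Γ.pt e t) = t * (1 - t / Γ.length e) := by
  classical
  rcases ht.1.eq_or_lt with rfl | h0
  · simp
  rcases ht.2.eq_or_lt with rfl | h1
  · simp [div_self (Γ.length_pos e).ne']
  · rw [pt_of_mem ⟨h0, h1⟩, bridge, if_pos rfl, min_self, max_self]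

variable [Fintype E]

namespace IsGreen

variable {o : V} {G : V → V → ℝ}

/-- On the diagonal, bilinear interpolation falls short of linear interpolation by r·t(L - t)/L²,
while `bridge` adds t(L - t)/L. -/
theorem pointKernel_pt_self (hG : Γ.IsGreen o G) {e : E} {t : ℝ} (ht : t ∈ Icc 0 (Γ.length e)) :
    Γ.pointKernel G (Γ.pt e t) (Γ.pt e t) =
      Γ.interp (fun v => G v v) (Γ.pt e t) +
        (Γ.length e - Γ.edgeResistance G e) / Γ.length e ^ 2 * (t * (Γ.length e - t)) := by
  have hL := (Γ.length_pos e).ne'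
  rw [pointKernel, bridge_pt_self ht, interp_pt _ ht, interp_pt _ ht, interp_pt _ ht,
    interp_pt _ ht, edgeResistance, hG.symm (Γ.tgt e) (Γ.src e)]
  field_simp
  ring

variable [Finite V]

/-- Along an edge the potential has constant slope and j_x(p,q) is quadratic in x, so each edge
contributes slope² · L · `meanVoltage`. -/
theorem A_eq (hG : Γ.IsGreen o G) (hΓ : Γ.Connected) (p q : V) :
    Γ.A (.vertex p) (.vertex q) = ∑ f, ((G (Γ.src f) p - G (Γ.src f) q) -
      (G (Γ.tgt f) p - G (Γ.tgt f) q)) ^ 2 / Γ.length f * Γ.meanVoltage G p q f := by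
  refine Finset.sum_congr rfl fun f _ => ?_
  have hL := (Γ.length_pos f).ne'
  have hd : ∀ t ∈ Ioo 0 (Γ.length f),
      deriv (fun s => Γ.voltage (.vertex p) (Γ.pt f s) (.vertex q)) t =
      ((G (Γ.src f) p - G (Γ.src f) q) - (G (Γ.tgt f) p - G (Γ.tgt f) q)) / Γ.length f :=
    fun t ht => by
    refine HasDerivAt.deriv ?_
    rw [← hasDerivWithinAt_univ]
    refine hasDerivWithinAt_of_eventually_affine (h := fun s =>
      Γ.voltage (.vertex p) (Γ.pt f s) (.vertex q)) ?_
    rw [nhdsWithin_univ]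
    filter_upwards [isOpen_Ioo.mem_nhds ht] with s hs
    simp only [hG.voltage_eq hΓ, pointKernel_vertex_right, interp_pt _ (Ioo_subset_Icc_self hs),
      interp_pt _ (Ioo_subset_Icc_self ht)]
    ring
  have hv : ∀ t ∈ Ioo 0 (Γ.length f), Γ.voltage (Γ.pt f t) (.vertex p) (.vertex q) =
      (G p q - G p (Γ.src f) - G q (Γ.src f) + G (Γ.src f) (Γ.src f)) +
      ((G p (Γ.src f) - G p (Γ.tgt f) + G q (Γ.src f) - G q (Γ.tgt f) +
        G (Γ.tgt f) (Γ.tgt f) - G (Γ.src f) (Γ.src f)) / Γ.length f +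
        (Γ.length f - Γ.edgeResistance G f) / Γ.length f) * t +
      (-(Γ.length f - Γ.edgeResistance G f) / Γ.length f ^ 2) * t ^ 2 := fun t ht => by
    rw [hG.voltage_eq hΓ, hG.pointKernel_pt_self (Ioo_subset_Icc_self ht),
      hG.pointKernel_comm (.vertex p) (Γ.pt f t)]
    simp only [pointKernel_vertex_right, interp_pt _ (Ioo_subset_Icc_self ht), interp_vertex]
    rw [hG.symm p (Γ.src f), hG.symm p (Γ.tgt f), hG.symm q (Γ.src f), hG.symm q (Γ.tgt f)]
    field_simp
    ring
  have hcongr : EqOn (fun t => Γ.voltage (Γ.pt f t) (.vertex p) (.vertex q) *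
      deriv (fun s => Γ.voltage (.vertex p) (Γ.pt f s) (.vertex q)) t ^ 2)
      (fun t => ((G p q - G p (Γ.src f) - G q (Γ.src f) + G (Γ.src f) (Γ.src f)) +
      ((G p (Γ.src f) - G p (Γ.tgt f) + G q (Γ.src f) - G q (Γ.tgt f) +
        G (Γ.tgt f) (Γ.tgt f) - G (Γ.src f) (Γ.src f)) / Γ.length f +
        (Γ.length f - Γ.edgeResistance G f) / Γ.length f) * t +
      (-(Γ.length f - Γ.edgeResistance G f) / Γ.length f ^ 2) * t ^ 2) *
      (((G (Γ.src f) p - G (Γ.src f) q) - (G (Γ.tgt f) p - G (Γ.tgt f) q)) / Γ.length f) ^ 2)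
      (Ioo 0 (Γ.length f)) := fun t ht => by
    simp only [hd t ht, hv t ht]
  rw [intervalIntegral.integral_congr_uIoo (by rwa [uIoo_of_le (Γ.length_pos f).le]),
    intervalIntegral.integral_mul_const, integral_quadratic, meanVoltage, edgeResistance]
  field_simp
  ring

omit [Finite V] in
-- The mean is the average of the two voltages at the ends of `f` plus (L - r)/6.
theorem meanVoltage_nonneg (hG : Γ.IsGreen o G) (p q : V) (f : E) :
    0 ≤ Γ.meanVoltage G p q f := by
  have h1 := hG.voltage_nonneg (Γ.src f) p q
  have h2 := hG.voltage_nonneg (Γ.tgt f) p q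
  have h3 := hG.edgeResistance_le f
  rw [edgeResistance] at h3
  rw [hG.symm (Γ.src f) q] at h1
  rw [hG.symm (Γ.tgt f) q] at h2
  rw [meanVoltage]
  linarith

theorem A_nonneg (hG : Γ.IsGreen o G) (hΓ : Γ.Connected) (p q : V) :
    0 ≤ Γ.A (.vertex p) (.vertex q) := by
  rw [hG.A_eq hΓ]
  exact Finset.sum_nonneg fun f _ => mul_nonneg
    (div_nonneg (sq_nonneg _) (Γ.length_pos f).le) (hG.meanVoltage_nonneg p q f)

theorem sum_deleteEdge_A [DecidableEq E] (hG : Γ.IsGreen o G) (hb : Γ.Bridgeless) :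
    ∑ e, Γ.length e * (Γ.deleteEdge e).A (.vertex (Γ.src e)) (.vertex (Γ.tgt e)) /
      (Γ.length e +
        (Γ.deleteEdge e).resistance (.vertex (Γ.src e)) (.vertex (Γ.tgt e))) ^ 2 =
    Γ.totalLength / 12 - ∑ e, ((Γ.length e - Γ.edgeResistance G e) ^ 2 / 12 +
      (G (Γ.src e) (Γ.src e) - G (Γ.tgt e) (Γ.tgt e)) ^ 2 / 4) / Γ.length e := by
  have hlt := fun e => hG.edgeResistance_lt (hb e)
  rw [← hG.sum_deleteEdge_meanVoltage hlt]
  refine Finset.sum_congr rfl fun e _ => ?_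
  have hL := (Γ.length_pos e).ne'
  have hLr : Γ.length e - Γ.edgeResistance G e ≠ 0 := (sub_pos.2 (hlt e)).ne'
  have hG' := hG.deleteEdge (hlt e)
  -- With this value of L + R, the factor (L/(L - r))² in A cancels and only the weight 1/L remains.
  have hR : Γ.length e + (Γ.deleteEdge e).resistance (.vertex (Γ.src e)) (.vertex (Γ.tgt e)) =
      Γ.length e ^ 2 / (Γ.length e - Γ.edgeResistance G e) := by
    rw [hG'.resistance_eq (hb e), pointKernel_vertex, pointKernel_vertex, pointKernel_vertex,
      hG.deletedKernel_resistance (hlt e)]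
    field_simp
    ring
  have hA : (Γ.deleteEdge e).A (.vertex (Γ.src e)) (.vertex (Γ.tgt e)) =
      (Γ.length e / (Γ.length e - Γ.edgeResistance G e)) ^ 2 * ∑ f : {f : E // f ≠ e},
      (Γ.edgePotential G e (Γ.src f) - Γ.edgePotential G e (Γ.tgt f)) ^ 2 / Γ.length f *
        (Γ.deleteEdge e).meanVoltage (Γ.deletedKernel G e) (Γ.src e) (Γ.tgt e) f := by
    rw [hG'.A_eq (hb e), Finset.mul_sum]
    refine Finset.sum_congr rfl fun f _ => ?_
    have h := hG.edgePotential_deletedKernel_sub (hlt e) (Γ.src f) (Γ.tgt f)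
    change ((Γ.deletedKernel G e (Γ.src f) (Γ.src e) - Γ.deletedKernel G e (Γ.src f) (Γ.tgt e)) -
      (Γ.deletedKernel G e (Γ.tgt f) (Γ.src e) - Γ.deletedKernel G e (Γ.tgt f) (Γ.tgt e))) ^ 2 /
      Γ.length f * _ = _
    rw [h]
    ring
  rw [hR, hA]
  field_simp

end IsGreen

end MetrizedGraph

/-! ### Integration against signed measures. -/

section SignedMeasure

variable {X : Type*} [MeasurableSpace X]

instance isFiniteMeasure_variation_signedMeasure (μ : SignedMeasure X) :
    IsFiniteMeasure μ.variation := by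
  rw [← SignedMeasure.totalVariation_eq_variation]
  infer_instance

theorem signedMeasure_integrable_of_bound (μ : SignedMeasure X) {f : X → ℝ} (hf : Measurable f)
    {C : ℝ} (hC : ∀ x, |f x| ≤ C) : μ.Integrable f :=
  Integrable.of_bound (μ := μ.variation) hf.aestronglyMeasurable C (Eventually.of_forall hC)

/-- The Jordan decomposition gives access to Fubini's theorem for positive measures. -/
theorem signedMeasure_integral_eq_sub (μ : SignedMeasure X) {f : X → ℝ} (hf : Measurable f)
    {C : ℝ} (hC : ∀ x, |f x| ≤ C) :
    ∫ᵛ x, f x ∂<•μ = ∫ x, f x ∂μ.toJordanDecomposition.posPart -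
      ∫ x, f x ∂μ.toJordanDecomposition.negPart := by
  conv_lhs => rw [← SignedMeasure.toSignedMeasure_toJordanDecomposition μ]
  rw [JordanDecomposition.toSignedMeasure, VectorMeasure.integral_sub_vectorMeasure
    (signedMeasure_integrable_of_bound _ hf hC) (signedMeasure_integrable_of_bound _ hf hC),
    VectorMeasure.integral_toSignedMeasure, VectorMeasure.integral_toSignedMeasure]

theorem measurable_intervalIntegral {k : ℝ → X → ℝ} (hk : Measurable (Function.uncurry k))
    {a b : ℝ} (hab : a ≤ b) : Measurable fun x => ∫ t in a..b, k t x := by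
  simp only [intervalIntegral.integral_of_le hab]
  exact (StronglyMeasurable.integral_prod_left hk.stronglyMeasurable).measurable

omit [MeasurableSpace X] in
theorem abs_intervalIntegral_le {k : ℝ → X → ℝ} {C : ℝ} (hC : ∀ t x, |k t x| ≤ C) (a b : ℝ)
    (x : X) : |∫ t in a..b, k t x| ≤ C * |b - a| :=
  intervalIntegral.norm_integral_le_of_norm_le_const (f := fun t => k t x) fun t _ => hC t x

theorem signedMeasure_integral_const_mul (μ : SignedMeasure X) (a : ℝ) (f : X → ℝ) :
    ∫ᵛ x, a * f x ∂<•μ = a * ∫ᵛ x, f x ∂<•μ :=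
  VectorMeasure.integral_fun_smul μ _ a f

theorem signedMeasure_integral_const (μ : SignedMeasure X) (a : ℝ) :
    ∫ᵛ _, a ∂<•μ = a * μ univ := by
  rw [VectorMeasure.integral_const]
  simp [mul_comm]

/-- Fubini's theorem for a signed measure and an interval. -/
theorem signedMeasure_integral_intervalIntegral_swap (μ : SignedMeasure X) {k : ℝ → X → ℝ}
    (hk : Measurable (Function.uncurry k)) {C : ℝ} (hC : ∀ t x, |k t x| ≤ C) {a b : ℝ}
    (hab : a ≤ b) :
    ∫ᵛ x, (∫ t in a..b, k t x) ∂<•μ = ∫ t in a..b, (∫ᵛ x, k t x ∂<•μ) := by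
  have hkx : ∀ t, Measurable (k t) := fun t => hk.of_uncurry_left
  have hint : ∀ ν : Measure X, IsFiniteMeasure ν → Integrable (Function.uncurry k)
      ((volume.restrict (Ioc a b)).prod ν) := fun ν _ =>
    Integrable.of_bound hk.aestronglyMeasurable C (Eventually.of_forall fun z => hC z.1 z.2)
  rw [signedMeasure_integral_eq_sub μ (measurable_intervalIntegral hk hab)
    (abs_intervalIntegral_le hC a b)]
  simp only [fun t => signedMeasure_integral_eq_sub μ (hkx t) (hC t),
    intervalIntegral.integral_of_le hab]
  have hpos := hint μ.toJordanDecomposition.posPart inferInstance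
  have hneg := hint μ.toJordanDecomposition.negPart inferInstance
  rw [← integral_integral_swap hpos, ← integral_integral_swap hneg]
  exact (integral_sub hpos.integral_prod_left hneg.integral_prod_left).symm

end SignedMeasure

/-! ### The canonical measure and the tau constant. -/

namespace MetrizedGraph

variable {V E : Type*} {Γ : MetrizedGraph V E}

instance [Finite V] [Finite E] : CompactSpace Γ.Point where
  isCompact_univ := by
    have h : (univ : Set Γ.Point) =
        (range fun v => Point.vertex v) ∪ ⋃ e, Γ.pt e '' Icc 0 (Γ.length e) := by
      refine (eq_univ_of_forall fun x => ?_).symm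
      cases x with
      | vertex v => exact Or.inl ⟨v, rfl⟩
      | interior e t =>
        exact Or.inr (mem_iUnion.2 ⟨e, t, Ioo_subset_Icc_self t.2, pt_coe e t⟩)
    rw [h]
    exact (finite_range _).isCompact.union
      (isCompact_iUnion fun e => isCompact_Icc.image (continuous_pt e))

theorem exists_abs_le_of_continuous [Finite V] [Finite E] {f : Γ.Point → ℝ} (hf : Continuous f) :
    ∃ C, ∀ x, |f x| ≤ C := by
  obtain ⟨C, hC⟩ := isCompact_univ.exists_bound_of_continuousOn hf.continuousOn
  exact ⟨C, fun x => hC x (mem_univ x)⟩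

theorem integrable_of_continuous [Finite V] [Finite E] (μ : SignedMeasure Γ.Point)
    {f : Γ.Point → ℝ} (hf : Continuous f) : μ.Integrable f := by
  obtain ⟨C, hC⟩ := exists_abs_le_of_continuous hf
  exact signedMeasure_integrable_of_bound μ hf.measurable hC

/-- The Lebesgue measure on the edge `e`. -/
def edgeMeasure (Γ : MetrizedGraph V E) (e : E) : Measure Γ.Point :=
  (volume.restrict (Ioc 0 (Γ.length e))).map (Γ.pt e)

instance (e : E) : IsFiniteMeasure (Γ.edgeMeasure e) := by
  rw [edgeMeasure]
  infer_instance

theorem integral_edgeMeasure (e : E) {f : Γ.Point → ℝ} (hf : Continuous f) :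
    ∫ x, f x ∂Γ.edgeMeasure e = ∫ t in (0 : ℝ)..Γ.length e, f (Γ.pt e t) := by
  rw [edgeMeasure, integral_map (continuous_pt e).measurable.aemeasurable
    hf.measurable.aestronglyMeasurable, intervalIntegral.integral_of_le (Γ.length_pos e).le]

theorem integral_interp (φ : V → ℝ) (e : E) :
    ∫ t in (0 : ℝ)..Γ.length e, Γ.interp φ (Γ.pt e t) =
      Γ.length e * (φ (Γ.src e) + φ (Γ.tgt e)) / 2 := by
  have hL := (Γ.length_pos e).ne'
  have h : ∫ t in (0 : ℝ)..Γ.length e, Γ.interp φ (Γ.pt e t) =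
      ∫ t in (0 : ℝ)..Γ.length e, (φ (Γ.src e) +
        (φ (Γ.tgt e) - φ (Γ.src e)) / Γ.length e * t + 0 * t ^ 2) :=
    intervalIntegral.integral_congr_Ioo_of_le (Γ.length_pos e).le fun t ht => by
      simp only [interp_pt φ (Ioo_subset_Icc_self ht)]
      ring
  rw [h, integral_quadratic]
  field_simp
  ring

theorem integral_bridge_self (e : E) (t' : Ioo 0 (Γ.length e)) :
    ∫ t in (0 : ℝ)..Γ.length e, Γ.bridge (Γ.pt e t) (.interior e t') =
      t' * (Γ.length e - t') / 2 := by
  have hL := (Γ.length_pos e).ne'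
  have hi : ∀ a b : ℝ, IntervalIntegrable
      (fun t => Γ.bridge (Γ.pt e t) (.interior e t')) volume a b := fun a b =>
    ((Γ.isPiecewiseAffine_bridge (.interior e t')).1.comp (continuous_pt e)).intervalIntegrable _ _
  rw [← intervalIntegral.integral_add_adjacent_intervals (hi 0 t') (hi t' _)]
  have h1 : ∫ t in (0 : ℝ)..t', Γ.bridge (Γ.pt e t) (.interior e t') =
      ∫ t in (0 : ℝ)..t', t * (1 - t' / Γ.length e) :=
    intervalIntegral.integral_congr_Ioo_of_le t'.2.1.le fun t ht => bridge_pt_of_le ht.1.le ht.2.le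
  have h2 : ∫ t in (t' : ℝ)..Γ.length e, Γ.bridge (Γ.pt e t) (.interior e t') =
      ∫ t in (t' : ℝ)..Γ.length e, (t' - t' / Γ.length e * t) :=
    intervalIntegral.integral_congr_Ioo_of_le t'.2.2.le fun t ht => by
      simp only [bridge_pt_of_ge ht.2.le ht.1.le]
      ring
  rw [h1, h2, intervalIntegral.integral_mul_const, integral_id, intervalIntegral.integral_sub
    (Continuous.intervalIntegrable (by fun_prop) _ _)
    (Continuous.intervalIntegrable (by fun_prop) _ _),
    intervalIntegral.integral_const_mul, integral_id, intervalIntegral.integral_const]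
  simp only [smul_eq_mul]
  field_simp
  ring

variable [Fintype E]

/-- The formula of Chinburg and Rumely for the canonical measure, in terms of a Green kernel. -/
def kernelMeasure [Fintype V] (Γ : MetrizedGraph V E) (G : V → V → ℝ) : SignedMeasure Γ.Point :=
  ∑ v, (Measure.dirac (Point.vertex v : Γ.Point)).toSignedMeasure +
    -- The density (L - r)/L² is 1/(L + R) on a non-bridge. The half masses total half the valence
    -- at each vertex, a self-loop counting twice.
    ∑ e, (((Γ.length e - Γ.edgeResistance G e) / Γ.length e ^ 2) •
      (Γ.edgeMeasure e).toSignedMeasure - (1 / 2 : ℝ) •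
        ((Measure.dirac (Point.vertex (Γ.src e) : Γ.Point)).toSignedMeasure +
          (Measure.dirac (Point.vertex (Γ.tgt e) : Γ.Point)).toSignedMeasure))

theorem integral_kernelMeasure [Fintype V] (G : V → V → ℝ) {f : Γ.Point → ℝ}
    (hf : Continuous f) :
    ∫ᵛ x, f x ∂<•(Γ.kernelMeasure G) = ∑ v, f (.vertex v) +
      ∑ e, ((Γ.length e - Γ.edgeResistance G e) / Γ.length e ^ 2 *
        (∫ t in (0 : ℝ)..Γ.length e, f (Γ.pt e t)) -
          1 / 2 * (f (.vertex (Γ.src e)) + f (.vertex (Γ.tgt e)))) := by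
  have hi : ∀ μ : SignedMeasure Γ.Point, μ.Integrable f := fun μ => integrable_of_continuous μ hf
  have hd : ∀ x : Γ.Point, ∫ y, f y ∂(Measure.dirac x) = f x := fun x =>
    integral_dirac' f x hf.measurable.stronglyMeasurable
  rw [kernelMeasure, VectorMeasure.integral_add_vectorMeasure (hi _) (hi _),
    VectorMeasure.integral_finsetSum_vectorMeasure fun _ _ => hi _,
    VectorMeasure.integral_finsetSum_vectorMeasure fun _ _ => hi _]
  simp only [VectorMeasure.integral_sub_vectorMeasure (hi _) (hi _),
    VectorMeasure.integral_add_vectorMeasure (hi _) (hi _),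
    VectorMeasure.integral_smul_vectorMeasure, VectorMeasure.integral_toSignedMeasure, hd,
    integral_edgeMeasure _ hf, smul_eq_mul]

namespace IsGreen

variable {o : V} {G : V → V → ℝ}

theorem continuous_pointKernel_diag (hG : Γ.IsGreen o G) :
    Continuous fun x => Γ.pointKernel G x x :=
  continuous_of_forall_edge (fun e t => G (Γ.src e) (Γ.src e) +
    (G (Γ.tgt e) (Γ.tgt e) - G (Γ.src e) (Γ.src e)) / Γ.length e * t +
    (Γ.length e - Γ.edgeResistance G e) / Γ.length e ^ 2 * (t * (Γ.length e - t)))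
    (fun e => by fun_prop) fun e t ht => by rw [hG.pointKernel_pt_self ht, interp_pt _ ht]

variable [Fintype V]

/-- The mass is the number of vertices minus the sum of r/L, which Foster's theorem evaluates. -/
theorem kernelMeasure_univ (hG : Γ.IsGreen o G) : Γ.kernelMeasure G univ = 1 := by
  have h := integral_kernelMeasure (Γ := Γ) G (f := fun _ => 1) continuous_const
  rw [signedMeasure_integral_const, one_mul] at h
  rw [h]
  have h1 : ∀ e, (Γ.length e - Γ.edgeResistance G e) / Γ.length e ^ 2 *
      (∫ t in (0 : ℝ)..Γ.length e, (1 : ℝ)) - 1 / 2 * (1 + 1) =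
      -(Γ.edgeResistance G e / Γ.length e) := fun e => by
    have hL := (Γ.length_pos e).ne'
    rw [intervalIntegral.integral_const, smul_eq_mul]
    field_simp
    ring
  rw [Finset.sum_congr rfl fun e _ => h1 e, Finset.sum_neg_distrib, hG.sum_edgeResistance_div]
  simp

theorem integral_kernelMeasure_diag (hG : Γ.IsGreen o G) :
    ∫ᵛ x, Γ.pointKernel G x x ∂<•(Γ.kernelMeasure G) =
      2 * ∑ e, ((Γ.length e - Γ.edgeResistance G e) ^ 2 / 12 +
      (G (Γ.src e) (Γ.src e) - G (Γ.tgt e) (Γ.tgt e)) ^ 2 / 4) / Γ.length e := by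
  rw [integral_kernelMeasure G hG.continuous_pointKernel_diag]
  simp only [pointKernel_vertex]
  have h1 : ∀ e, ∫ t in (0 : ℝ)..Γ.length e, Γ.pointKernel G (Γ.pt e t) (Γ.pt e t) =
      Γ.length e * (G (Γ.src e) (Γ.src e) + G (Γ.tgt e) (Γ.tgt e)) / 2 +
        Γ.length e * (Γ.length e - Γ.edgeResistance G e) / 6 := fun e => by
    have hL := (Γ.length_pos e).ne'
    have h : ∫ t in (0 : ℝ)..Γ.length e, Γ.pointKernel G (Γ.pt e t) (Γ.pt e t) =
        ∫ t in (0 : ℝ)..Γ.length e, (G (Γ.src e) (Γ.src e) +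
          ((G (Γ.tgt e) (Γ.tgt e) - G (Γ.src e) (Γ.src e)) / Γ.length e +
            (Γ.length e - Γ.edgeResistance G e) / Γ.length e) * t +
          -((Γ.length e - Γ.edgeResistance G e) / Γ.length e ^ 2) * t ^ 2) :=
      intervalIntegral.integral_congr_Ioo_of_le (Γ.length_pos e).le fun t ht => by
        simp only [hG.pointKernel_pt_self (Ioo_subset_Icc_self ht),
          interp_pt _ (Ioo_subset_Icc_self ht)]
        field_simp
        ring
    rw [h, integral_quadratic]
    field_simp
    ring
  have h2 : ∑ v, G v v = (2 * ∑ v, G v v) / 2 := by ring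
  rw [h2, hG.two_mul_sum_diag, Finset.sum_div, ← Finset.sum_add_distrib, Finset.mul_sum]
  refine Finset.sum_congr rfl fun e _ => ?_
  have hL := (Γ.length_pos e).ne'
  rw [h1]
  field_simp
  ring

/-- The interpolated part follows from `diag_eq`. The bridge part sees only the edge containing `x`,
where it supplies half of the quadratic term in `pointKernel_pt_self`. -/
theorem integral_kernelMeasure_pointKernel (hG : Γ.IsGreen o G) (x : Γ.Point) :
    ∫ᵛ ζ, Γ.pointKernel G ζ x ∂<•(Γ.kernelMeasure G) = Γ.pointKernel G x x / 2 := by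
  have hci : Continuous (Γ.interp fun u => Γ.interp (G u) x) :=
    (Γ.isPiecewiseAffine_interp _).1
  have hcb : Continuous fun ζ => Γ.bridge ζ x := (Γ.isPiecewiseAffine_bridge x).1
  simp only [pointKernel]
  rw [VectorMeasure.integral_fun_add (integrable_of_continuous _ hci)
    (integrable_of_continuous _ hcb), integral_kernelMeasure G hci, integral_kernelMeasure G hcb]
  simp only [integral_interp, interp_vertex, bridge_vertex_left, Finset.sum_const_zero, add_zero,
    zero_add, mul_zero, sub_zero]
  have h1 : ∑ v, Γ.interp (G v) x + ∑ e, ((Γ.length e - Γ.edgeResistance G e) / Γ.length e ^ 2 *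
      (Γ.length e * (Γ.interp (G (Γ.src e)) x + Γ.interp (G (Γ.tgt e)) x) / 2) -
        1 / 2 * (Γ.interp (G (Γ.src e)) x + Γ.interp (G (Γ.tgt e)) x)) =
      Γ.interp (fun v => G v v) x / 2 := by
    obtain ⟨p, q, a, -, -, h⟩ := exists_interp_eq x
    simp only [h]
    rw [hG.diag_eq p, hG.diag_eq q, Finset.sum_add_distrib, ← Finset.mul_sum, ← Finset.mul_sum]
    have h2 : ∀ e, (Γ.length e - Γ.edgeResistance G e) / Γ.length e ^ 2 *
        (Γ.length e * ((1 - a) * G (Γ.src e) p + a * G (Γ.src e) q +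
          ((1 - a) * G (Γ.tgt e) p + a * G (Γ.tgt e) q)) / 2) -
        1 / 2 * ((1 - a) * G (Γ.src e) p + a * G (Γ.src e) q +
          ((1 - a) * G (Γ.tgt e) p + a * G (Γ.tgt e) q)) =
        -((1 - a) / 2) * (Γ.edgeResistance G e / Γ.length e * (G (Γ.src e) p + G (Γ.tgt e) p)) -
        a / 2 * (Γ.edgeResistance G e / Γ.length e * (G (Γ.src e) q + G (Γ.tgt e) q)) :=
      fun e => by
      have hL := (Γ.length_pos e).ne'
      field_simp
      ring
    rw [Finset.sum_congr rfl fun e _ => h2 e, Finset.sum_sub_distrib, ← Finset.mul_sum,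
      ← Finset.mul_sum]
    ring
  rw [h1]
  cases x with
  | vertex v => simp [interp_vertex]
  | interior e t' =>
    rw [Finset.sum_eq_single e]
    · have h3 := hG.pointKernel_pt_self (Ioo_subset_Icc_self t'.2)
      rw [pt_coe, pointKernel] at h3
      rw [h3, integral_bridge_self]
      ring
    · intro e' _ hne
      simp [bridge_pt_of_ne hne]
    · simp

theorem continuous_resistance (hG : Γ.IsGreen o G) (hΓ : Γ.Connected) (x : Γ.Point) :
    Continuous fun ζ => Γ.resistance ζ x := by
  simp only [hG.resistance_eq hΓ]
  have h1 := hG.continuous_pointKernel_diag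
  have h2 := (Γ.isPiecewiseAffine_pointKernel G x).1
  fun_prop

theorem resistance_comm (hG : Γ.IsGreen o G) (hΓ : Γ.Connected) (x y : Γ.Point) :
    Γ.resistance x y = Γ.resistance y x := by
  rw [hG.resistance_eq hΓ, hG.resistance_eq hΓ, hG.pointKernel_comm x y]
  ring

omit [Fintype V] in
theorem exists_abs_pointKernel_le [Finite V] (Γ : MetrizedGraph V E) (G : V → V → ℝ) :
    ∃ C, ∀ x y, |Γ.pointKernel G x y| ≤ C := by
  cases nonempty_fintype V
  have hC1 : ∀ u v, |G u v| ≤ ∑ u, ∑ v, |G u v| := fun u v =>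
    (Finset.single_le_sum (f := fun v => |G u v|) (fun _ _ => abs_nonneg _)
      (Finset.mem_univ v)).trans (Finset.single_le_sum (f := fun u => ∑ v, |G u v|)
        (fun _ _ => Finset.sum_nonneg fun _ _ => abs_nonneg _) (Finset.mem_univ u))
  have hC2 : ∀ e, Γ.length e ≤ ∑ e, Γ.length e := fun e =>
    Finset.single_le_sum (fun e _ => (Γ.length_pos e).le) (Finset.mem_univ e)
  refine ⟨∑ u, ∑ v, |G u v| + ∑ e, Γ.length e, fun x y => (abs_add_le _ _).trans ?_⟩
  refine add_le_add (abs_interp_le (fun u => abs_interp_le (hC1 u) y) x) ?_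
  rw [abs_of_nonneg (bridge_nonneg x y)]
  exact bridge_le hC2 (Finset.sum_nonneg fun e _ => (Γ.length_pos e).le) x y

theorem exists_abs_resistance_le (hG : Γ.IsGreen o G) (hΓ : Γ.Connected) :
    ∃ C, ∀ x y, |Γ.resistance x y| ≤ C := by
  obtain ⟨C, hC⟩ := exists_abs_pointKernel_le Γ G
  refine ⟨4 * C, fun x y => ?_⟩
  have h1 := abs_le.1 (hC x x)
  have h2 := abs_le.1 (hC y y)
  have h3 := abs_le.1 (hC x y)
  rw [hG.resistance_eq hΓ, abs_le]
  constructor <;> linarith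

/-- Here j_ζ(x,x) = K(ζ,ζ) + K(x,x) - 2K(ζ,x). The mass 1 and the preceding integral make the terms
in x cancel, leaving ∫ K(ζ,ζ) dμ. -/
theorem voltageIntegral_kernelMeasure (hG : Γ.IsGreen o G) (hΓ : Γ.Connected) (x : Γ.Point) :
    Γ.voltageIntegral (Γ.kernelMeasure G) x x =
      2 * ∑ e, ((Γ.length e - Γ.edgeResistance G e) ^ 2 / 12 +
      (G (Γ.src e) (Γ.src e) - G (Γ.tgt e) (Γ.tgt e)) ^ 2 / 4) / Γ.length e := by
  have h1 := hG.continuous_pointKernel_diag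
  have h2 := (Γ.isPiecewiseAffine_pointKernel G x).1
  change ∫ᵛ ζ, Γ.resistance ζ x ∂<•(Γ.kernelMeasure G) = _
  simp only [hG.resistance_eq hΓ]
  rw [VectorMeasure.integral_fun_sub (integrable_of_continuous _ (by fun_prop))
    (integrable_of_continuous _ (by fun_prop)),
    VectorMeasure.integral_fun_add (integrable_of_continuous _ h1)
    (integrable_of_continuous _ continuous_const), signedMeasure_integral_const]
  rw [signedMeasure_integral_const_mul, hG.integral_kernelMeasure_pointKernel,
    hG.integral_kernelMeasure_diag, hG.kernelMeasure_univ]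
  ring

theorem isCanonicalMeasure_kernelMeasure (hG : Γ.IsGreen o G) (hΓ : Γ.Connected) :
    Γ.IsCanonicalMeasure (Γ.kernelMeasure G) :=
  ⟨hG.kernelMeasure_univ, _, hG.voltageIntegral_kernelMeasure hΓ⟩

/-- The constant attached to a canonical measure does not depend on the measure. -/
theorem voltageIntegral_eq_of_isCanonicalMeasure (hG : Γ.IsGreen o G) (hΓ : Γ.Connected)
    {μ : SignedMeasure Γ.Point} (hμ : Γ.IsCanonicalMeasure μ) (x : Γ.Point) :
    Γ.voltageIntegral μ x x =
      2 * ∑ e, ((Γ.length e - Γ.edgeResistance G e) ^ 2 / 12 +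
      (G (Γ.src e) (Γ.src e) - G (Γ.tgt e) (Γ.tgt e)) ^ 2 / 4) / Γ.length e := by
  obtain ⟨hμ1, c, hc⟩ := hμ
  obtain ⟨C, hC⟩ := hG.exists_abs_resistance_le hΓ
  have hc' : ∀ ζ, ∫ᵛ x, Γ.resistance ζ x ∂<•μ = c := fun ζ => by
    simp only [hG.resistance_comm hΓ ζ]
    exact hc ζ
  have hcx : ∀ ζ, Continuous fun x => Γ.resistance ζ x := fun ζ => by
    simp only [hG.resistance_comm hΓ ζ]
    exact hG.continuous_resistance hΓ ζ
  have hJm : ∀ e, Measurable (Function.uncurry fun t x => Γ.resistance (Γ.pt e t) x) := fun e =>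
    measurable_uncurry_of_continuous_of_measurable
      (fun x => (hG.continuous_resistance hΓ x).comp (continuous_pt e))
      fun t => (hcx _).measurable
  have hJ : ∀ e, ∫ᵛ x, (∫ t in (0 : ℝ)..Γ.length e, Γ.resistance (Γ.pt e t) x) ∂<•μ =
      Γ.length e * c := fun e => by
    rw [signedMeasure_integral_intervalIntegral_swap μ (hJm e) (fun t x => hC _ _)
      (Γ.length_pos e).le]
    simp only [hc', intervalIntegral.integral_const, sub_zero, smul_eq_mul]
  have hJi : ∀ e, μ.Integrable fun x => ∫ t in (0 : ℝ)..Γ.length e, Γ.resistance (Γ.pt e t) x :=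
    fun e => signedMeasure_integrable_of_bound μ
      (measurable_intervalIntegral (hJm e) (Γ.length_pos e).le)
      (abs_intervalIntegral_le (fun t x => hC (Γ.pt e t) x) _ _)
  have hi : ∀ ζ, μ.Integrable fun x => Γ.resistance ζ x := fun ζ => integrable_of_continuous μ (hcx ζ)
  set T := 2 * ∑ e, ((Γ.length e - Γ.edgeResistance G e) ^ 2 / 12 +
      (G (Γ.src e) (Γ.src e) - G (Γ.tgt e) (Γ.tgt e)) ^ 2 / 4) / Γ.length e with hT
  -- Integrated against `μ`, this computes the double integral of the symmetric resistance in both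
  -- orders: the left side gives `T`, as `μ` has mass 1, and the right side gives `c` times the mass
  -- 1 of `kernelMeasure`.
  have key : ∀ x, T = ∑ v, Γ.resistance (.vertex v) x +
      ∑ e, ((Γ.length e - Γ.edgeResistance G e) / Γ.length e ^ 2 *
        (∫ t in (0 : ℝ)..Γ.length e, Γ.resistance (Γ.pt e t) x) -
          1 / 2 * (Γ.resistance (.vertex (Γ.src e)) x + Γ.resistance (.vertex (Γ.tgt e)) x)) :=
    fun x => by
    rw [hT, ← hG.voltageIntegral_kernelMeasure hΓ x,
      ← integral_kernelMeasure G (hG.continuous_resistance hΓ x)]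
    rfl
  have hTμ : ∫ᵛ _, T ∂<•μ = T := by rw [signedMeasure_integral_const, hμ1, mul_one]
  have hi1 : ∀ e, μ.Integrable fun x => (Γ.length e - Γ.edgeResistance G e) / Γ.length e ^ 2 *
      (∫ t in (0 : ℝ)..Γ.length e, Γ.resistance (Γ.pt e t) x) := fun e => (hJi e).const_mul _
  have hi2 : ∀ e, μ.Integrable fun x => 1 / 2 *
      (Γ.resistance (.vertex (Γ.src e)) x + Γ.resistance (.vertex (Γ.tgt e)) x) := fun e =>
    ((hi _).fun_add (hi _)).const_mul _
  have hedge : ∀ e, ∫ᵛ x, ((Γ.length e - Γ.edgeResistance G e) / Γ.length e ^ 2 *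
      (∫ t in (0 : ℝ)..Γ.length e, Γ.resistance (Γ.pt e t) x) - 1 / 2 *
        (Γ.resistance (.vertex (Γ.src e)) x + Γ.resistance (.vertex (Γ.tgt e)) x)) ∂<•μ =
      -(Γ.edgeResistance G e / Γ.length e) * c := fun e => by
    have hL := (Γ.length_pos e).ne'
    rw [VectorMeasure.integral_fun_sub (hi1 e) (hi2 e), signedMeasure_integral_const_mul,
      signedMeasure_integral_const_mul, VectorMeasure.integral_fun_add (hi _) (hi _), hJ, hc', hc']
    field_simp
    ring
  rw [hc x, ← hTμ, funext key, VectorMeasure.integral_fun_add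
    (VectorMeasure.Integrable.fun_finsetSum _ fun v _ => hi _)
    (VectorMeasure.Integrable.fun_finsetSum _ fun e _ => (hi1 e).fun_sub (hi2 e)),
    VectorMeasure.integral_finsetSum _ fun v _ => hi _,
    VectorMeasure.integral_finsetSum _ fun e _ => (hi1 e).fun_sub (hi2 e),
    Finset.sum_congr rfl fun e _ => hedge e, ← Finset.sum_mul, Finset.sum_neg_distrib,
    hG.sum_edgeResistance_div]
  simp only [hc', Finset.sum_const, Finset.card_univ, nsmul_eq_mul]
  ring

theorem isCanonicalMeasure_canonicalMeasure (hG : Γ.IsGreen o G) (hΓ : Γ.Connected) :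
    Γ.IsCanonicalMeasure Γ.canonicalMeasure :=
  Classical.epsilon_spec ⟨_, hG.isCanonicalMeasure_kernelMeasure hΓ⟩

/-- The tau constant in terms of a Green kernel. -/
theorem tau_eq (hG : Γ.IsGreen o G) (hΓ : Γ.Connected) :
    Γ.tau = ∑ e, ((Γ.length e - Γ.edgeResistance G e) ^ 2 / 12 +
      (G (Γ.src e) (Γ.src e) - G (Γ.tgt e) (Γ.tgt e)) ^ 2 / 4) / Γ.length e := by
  have h := hG.voltageIntegral_eq_of_isCanonicalMeasure hΓ
    (hG.isCanonicalMeasure_canonicalMeasure hΓ)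
  have hspec := Classical.epsilon_spec (p := fun t : ℝ =>
    ∀ x, 1 / 2 * Γ.voltageIntegral Γ.canonicalMeasure x x = t) ⟨_, fun x => by rw [h x]⟩
  rw [tau, ← hspec (.vertex o), h]
  ring

end IsGreen

/-- The tau constant of a bridgeless metrized graph. -/
theorem Bridgeless.tau_eq [Finite V] [DecidableEq E] (hb : Γ.Bridgeless) (hΓ : Γ.Connected) :
    Γ.IsCanonicalMeasure Γ.canonicalMeasure ∧
      Γ.tau = Γ.totalLength / 12 -
        ∑ e, Γ.length e *
            (Γ.deleteEdge e).A (.vertex (Γ.src e)) (.vertex (Γ.tgt e)) /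
          (Γ.length e +
            (Γ.deleteEdge e).resistance (.vertex (Γ.src e)) (.vertex (Γ.tgt e))) ^ 2 ∧
      (Γ.totalLength = 1 → Γ.tau ≤ 1 / 12) := by
  cases nonempty_fintype V
  obtain ⟨o⟩ := hΓ.nonempty
  obtain ⟨G, hG⟩ := hΓ.exists_isGreen o
  have htau : Γ.tau = Γ.totalLength / 12 -
      ∑ e, Γ.length e * (Γ.deleteEdge e).A (.vertex (Γ.src e)) (.vertex (Γ.tgt e)) /
        (Γ.length e +
          (Γ.deleteEdge e).resistance (.vertex (Γ.src e)) (.vertex (Γ.tgt e))) ^ 2 := by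
    rw [hG.tau_eq hΓ, hG.sum_deleteEdge_A hb]
    ring
  refine ⟨hG.isCanonicalMeasure_canonicalMeasure hΓ, htau, fun h => ?_⟩
  rw [htau, h, sub_le_self_iff]
  exact Finset.sum_nonneg fun e _ => div_nonneg (mul_nonneg (Γ.length_pos e).le
    ((hG.deleteEdge (hG.edgeResistance_lt (hb e))).A_nonneg (hb e) _ _)) (sq_nonneg _)

omit [Fintype E] in
theorem connected_of_subsingleton [Nonempty V] [Subsingleton V] (Γ : MetrizedGraph V E) :
    Γ.Connected where
  preconnected u v := by rw [Subsingleton.elim u v]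
  nonempty := inferInstance

theorem tau_unitCircle : unitCircle.tau = 1 / 12 := by
  have h := (Bridgeless.tau_eq (Γ := unitCircle) (fun _ => connected_of_subsingleton _)
    (connected_of_subsingleton _)).2.1
  -- Without its only edge the circle is a single vertex, so the integral is an empty sum.
  have hA : ∀ e p q, (unitCircle.deleteEdge e).A p q = 0 := fun e p q =>
    Finset.sum_eq_zero fun f _ => absurd (Subsingleton.elim f.1 e) f.2
  rw [h]
  simp only [hA]
  simp [totalLength, unitCircle]

end MetrizedGraph

end

theorem mainTheorem4 :
    (∀ (V : Type*) (E : Type*) [Finite V] [Fintype E] [DecidableEq E] (Γ : MetrizedGraph V E),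
      Γ.Connected → Γ.Bridgeless →
        Γ.IsCanonicalMeasure Γ.canonicalMeasure ∧
        Γ.tau = Γ.totalLength / 12 -
          ∑ e, Γ.length e *
              (Γ.deleteEdge e).A (.vertex (Γ.src e)) (.vertex (Γ.tgt e)) /
            (Γ.length e +
              (Γ.deleteEdge e).resistance (.vertex (Γ.src e)) (.vertex (Γ.tgt e))) ^ 2 ∧
        (Γ.totalLength = 1 → Γ.tau ≤ 1 / 12)) ∧
    (MetrizedGraph.unitCircle.Connected ∧ MetrizedGraph.unitCircle.Bridgeless ∧
      MetrizedGraph.unitCircle.totalLength = 1 ∧ MetrizedGraph.unitCircle.tau = 1 / 12) := by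
  refine ⟨fun V E _ _ _ Γ hΓ hb => hb.tau_eq hΓ, MetrizedGraph.connected_of_subsingleton _,
    fun _ => MetrizedGraph.connected_of_subsingleton _, ?_, MetrizedGraph.tau_unitCircle⟩
  simp [MetrizedGraph.totalLength, MetrizedGraph.unitCircle]
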